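/- For an immersion $c\in C^\infty([0,2\pi],\mathbb R^2)$ (that is, $c'(\theta)\neq 0$ for all $\theta$) write $D_s=\frac{1}{|c'|}\partial_\theta$, $ds=|c'|\,d\theta$, $v=D_sc$ for the unit tangent and $n$ for $v$ rotated by $+\pi/2$. Let $\mathrm{Imm}([0,2\pi],\mathbb R^2)/\mathrm{Mot}$ be the space of such open curves modulo Euclidean motions (translations and rotations), identified with the set of immersions $c$ with $c(0)=0$ and $v(0)=(1,0)$. This is an open subset of the Fréchet space of all $h\in C^\infty([0,2\pi],\mathbb R^2)$ with $h(0)=0$ and $h'(0)\in\mathbb R\times\{0\}$, so that its tangent space at $c$ is $$T_c=\{h\in C^\infty([0,2\pi],\mathbb R^2): h(0)=0,\ \langle D_sh(0),n(0)\rangle=0\}.$$ Equip it with the weak Riemannian metric $$G_c(h,k)=\int_0^{2\pi}\langle D_sh,v\rangle\langle D_sk,v\rangle+\langle D_s^2h,n\rangle\langle D_s^2k,n\rangle\,ds .$$ Then $G$ has a unique (smooth) Levi-Civita connection, and for every $c$ and all linearly independent $h,k\in T_c$ one has $G_c(h,h)G_c(k,k)-G_c(h,k)^2>0$, and the sectional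 curvature $\frac{G_c(R(h,k)k,h)}{G_c(h,h)G_c(k,k)-G_c(h,k)^2}$ of the plane spanned by $h,k$, where $R(X,Y)Z=\nabla_X\nabla_YZ-\nabla_Y\nabla_XZ-\nabla_{[X,Y]}Z$, equals $$\mathrm k_c(P(h,k))=\frac{-3\int_0^{2\pi}\big(\langle D_sh,v\rangle\langle D_s^2k,n\rangle-\langle D_sk,v\rangle\langle D_s^2h,n\rangle\big)^2\,ds}{G_c(h,h)G_c(k,k)-G_c(h,k)^2}.$$ In particular the sectional curvature is non-positive. -/

import Mathlib

open scoped ContDiff InnerProductSpace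

noncomputable section

namespace PlaneCurves

/-- The Euclidean plane. -/
abbrev Plane : Type := EuclideanSpace ℝ (Fin 2)

/-- The parameter interval `[0, 2π]`. -/
abbrev J : Set ℝ := Set.Icc 0 (2 * Real.pi)

/-- A map `[0, 2π] → ℝ²`, extended to the real line by its end values. All notions below only
depend on the restriction of the extended map to `[0, 2π]`. -/
def ext (f : J → Plane) : ℝ → Plane := Set.IccExtend Real.two_pi_pos.le f

/-- The derivative `f' = ∂_θ f` on `[0, 2π]` (one-sided at the end points). -/
def dθ (f : ℝ → Plane) : ℝ → Plane := fun θ => derivWithin f J θ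

/-- The length element `|c'|`. -/
def speed (c : ℝ → Plane) : ℝ → ℝ := fun θ => ‖dθ c θ‖

/-- The arc length derivative `D_s = |c'|⁻¹ ∂_θ` along `c`. -/
def Ds (c f : ℝ → Plane) : ℝ → Plane := fun θ => (speed c θ)⁻¹ • dθ f θ

/-- The unit tangent vector `v = D_s c`. -/
def unitTangent (c : ℝ → Plane) : ℝ → Plane := Ds c c

/-- The rotation by `π / 2`. -/
def rot (x : Plane) : Plane := !₂[-x 1, x 0]

/-- The unit normal vector `n`, the tangent `v` rotated by `π / 2`. -/
def unitNormal (c : ℝ → Plane) : ℝ → Plane := fun θ => rot (unitTangent c θ)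

/-- The tangential component `⟨D_s h, v⟩`. -/
def tangentialPart (c h : ℝ → Plane) : ℝ → ℝ := fun θ => ⟪Ds c h θ, unitTangent c θ⟫_ℝ

/-- The second order normal component `⟨D_s² h, n⟩`. -/
def normalPart (c h : ℝ → Plane) : ℝ → ℝ := fun θ => ⟪Ds c (Ds c h) θ, unitNormal c θ⟫_ℝ

/-- Integration over `[0, 2π]` with respect to arc length, `ds = |c'| dθ`. -/
def arcIntegral (c : ℝ → Plane) (f : ℝ → ℝ) : ℝ :=
  ∫ θ in (0 : ℝ)..(2 * Real.pi), f θ * speed c θ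

/-- The metric `G_c(h,k) = ∫ ⟨D_s h, v⟩⟨D_s k, v⟩ + ⟨D_s² h, n⟩⟨D_s² k, n⟩ ds`. -/
def metric (c h k : ℝ → Plane) : ℝ :=
  arcIntegral c fun θ =>
    tangentialPart c h θ * tangentialPart c k θ + normalPart c h θ * normalPart c k θ

theorem uniqueDiffOn_J : UniqueDiffOn ℝ J := uniqueDiffOn_Icc Real.two_pi_pos

theorem zero_mem_J : (0 : ℝ) ∈ J := Set.left_mem_Icc.2 Real.two_pi_pos.le

theorem ext_add (f g : J → Plane) : ext (f + g) = ext f + ext g := rfl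

theorem ext_smul (r : ℝ) (f : J → Plane) : ext (r • f) = r • ext f := rfl

theorem differentiableWithinAt_of_smooth {f : ℝ → Plane} (hf : ContDiffOn ℝ ∞ f J) :
    DifferentiableWithinAt ℝ f J 0 :=
  hf.differentiableOn (by simp) 0 zero_mem_J

/-- The closed subspace of all `h ∈ C^∞([0,2π], ℝ²)` with `h(0) = 0` and `h'(0) ∈ ℝ × {0}`. -/
def V : Submodule ℝ (J → Plane) where
  carrier := {h | ContDiffOn ℝ ∞ (ext h) J ∧ ext h 0 = 0 ∧ dθ (ext h) 0 1 = 0}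
  zero_mem' := by
    have h0 : ext (0 : J → Plane) = fun _ => 0 := rfl
    refine ⟨?_, ?_, ?_⟩
    · rw [h0]; exact contDiffOn_const
    · rw [h0]
    · simp [h0, dθ]
  add_mem' := by
    rintro f g ⟨hf, hf0, hf1⟩ ⟨hg, hg0, hg1⟩
    refine ⟨?_, ?_, ?_⟩
    · rw [ext_add]; exact hf.add hg
    · simp [ext_add, hf0, hg0]
    · have := derivWithin_add (differentiableWithinAt_of_smooth hf)
        (differentiableWithinAt_of_smooth hg)
      simp only [dθ] at hf1 hg1
      simp [ext_add, dθ, this, hf1, hg1]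
  smul_mem' := by
    rintro r f ⟨hf, hf0, hf1⟩
    refine ⟨?_, ?_, ?_⟩
    · rw [ext_smul]; exact hf.const_smul r
    · simp [ext_smul, hf0]
    · have := derivWithin_const_smul r (differentiableWithinAt_of_smooth hf)
      simp only [dθ] at hf1
      simp [ext_smul, dθ, this, hf1]

/-- An element of `V` as a map on the real line, see `ext`. -/
def toFun (h : V) : ℝ → Plane := ext h.1

/-- The manifold `Imm([0,2π], ℝ²)/Mot` of open curves modulo Euclidean motions, identified with
the section of all immersions `c` with `c(0) = 0` and turning angle `α(0) = 0`, that is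
`v(0) = (cos 0, sin 0) = (1, 0)`. It is an open subset of the Fréchet space `V`, so `V` is its
tangent space at every point. -/
def curvesModMot : Set V :=
  {c | (∀ θ ∈ J, dθ (toFun c) θ ≠ 0) ∧ unitTangent (toFun c) 0 = !₂[1, 0]}

/-- For every curve `c` of the manifold, `V` is the tangent space
`{h ∈ C^∞([0,2π], ℝ²) : h(0) = 0, ⟨D_s h(0), n(0)⟩ = 0}`. -/
theorem mem_V_iff {c : V} (hc : c ∈ curvesModMot) (h : J → Plane) :
    h ∈ V ↔ ContDiffOn ℝ ∞ (ext h) J ∧ ext h 0 = 0 ∧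
      ⟪Ds (toFun c) (ext h) 0, unitNormal (toFun c) 0⟫_ℝ = 0 := by
  have hs : speed (toFun c) 0 ≠ 0 := norm_ne_zero_iff.2 (hc.1 0 zero_mem_J)
  have hn : unitNormal (toFun c) 0 = !₂[0, 1] := by
    simp [unitNormal, hc.2, rot]
  have key : ⟪Ds (toFun c) (ext h) 0, unitNormal (toFun c) 0⟫_ℝ = 0 ↔
      dθ (ext h) 0 1 = 0 := by
    rw [hn]
    simp [Ds, PiLp.inner_apply, Fin.sum_univ_two, hs]
  rw [key]
  rfl

/-- Smooth curves `ℝ → V`: the map `(t, θ) ↦ γ(t)(θ)` is smooth on `ℝ × [0, 2π]`. -/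
def IsSmoothCurve (γ : ℝ → V) : Prop :=
  ContDiffOn ℝ ∞ (fun p : ℝ × ℝ => toFun (γ p.1) p.2) (Set.univ ×ˢ J)

/-- `Γ` is the Christoffel map of a Levi-Civita connection of the metric on `curvesModMot`, in the
global chart given by the inclusion into `V`: the covariant derivative is
`∇_X Y = dY(X) + Γ(X, Y)`. Smoothness of `(c, h, k) ↦ Γ_c(h, k)` means that smooth curves are mapped
to smooth curves. The values of `Γ_c` for `c` outside of the manifold are irrelevant. -/
structure IsLeviCivita (Γ : V → V →ₗ[ℝ] V →ₗ[ℝ] V) : Prop where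
  smooth : ∀ γ η ζ : ℝ → V, IsSmoothCurve γ → IsSmoothCurve η → IsSmoothCurve ζ →
    (∀ t, γ t ∈ curvesModMot) → IsSmoothCurve fun t => Γ (γ t) (η t) (ζ t)
  torsion_free : ∀ c ∈ curvesModMot, ∀ h k, Γ c h k = Γ c k h
  metric_compatible : ∀ c ∈ curvesModMot, ∀ m h k : V,
    HasDerivAt (fun t : ℝ => metric (toFun (c + t • m)) (toFun h) (toFun k))
      (metric (toFun c) (toFun (Γ c m h)) (toFun k)
        + metric (toFun c) (toFun h) (toFun (Γ c m k))) 0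

/-- The derivative `(D_{c,m} Γ)(h, k)` of `c ↦ Γ_c(h, k)` at `c` in the direction `m`. -/
def dΓ (Γ : V → V →ₗ[ℝ] V →ₗ[ℝ] V) (c m h k : V) : ℝ → Plane :=
  fun θ => deriv (fun t : ℝ => toFun (Γ (c + t • m) h k) θ) 0

/-- The curvature tensor `R(h,k)l = ∇_h ∇_k l - ∇_k ∇_h l - ∇_[h,k] l`, at the point `c`, of the
connection with Christoffel map `Γ`; in the chart, with constant vector fields `h, k, l`. -/
def curvatureTensor (Γ : V → V →ₗ[ℝ] V →ₗ[ℝ] V) (c h k l : V) : ℝ → Plane :=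
  dΓ Γ c h k l - dΓ Γ c k h l + toFun (Γ c h (Γ c k l)) - toFun (Γ c k (Γ c h l))

/-- The squared area `G(h,h) G(k,k) - G(h,k)²` of the parallelogram spanned by `h, k`. -/
def gram (c h k : V) : ℝ :=
  metric (toFun c) (toFun h) (toFun h) * metric (toFun c) (toFun k) (toFun k)
    - metric (toFun c) (toFun h) (toFun k) ^ 2

/-- The sectional curvature `G(R(h,k)k, h) / (G(h,h) G(k,k) - G(h,k)²)` of the plane spanned by
`h, k`. -/
def sectionalCurvature (Γ : V → V →ₗ[ℝ] V →ₗ[ℝ] V) (c h k : V) : ℝ :=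
  metric (toFun c) (curvatureTensor Γ c h k k) (toFun h) / gram c h k

end PlaneCurves

end

/-!
Let `α` be the turning angle of a curve `c`. Then `c ↦ (r, μ) = (|c'|, |c'| α')` is a global chart
of the space of curves onto the smooth maps from `[0, 2π]` to the right half-plane, because `c'`
is recovered by integrating `α' = μ / r` from `α(0) = 0`. The derivatives of `r` and `μ` along `h`
are `r ⟨D_s h, v⟩` and `r² ⟨D_s² h, n⟩`, so the chart turns the metric into the `L²` metric of maps
into the half-plane with the Riemannian metric `dr² / r + dμ² / r³`. The geometry of such an `L²`
metric is computed point by point in the target, and here the target has Gauss curvature `-3 / r`.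
-/

open scoped ContDiff InnerProductSpace Topology

noncomputable section

namespace PlaneCurves
section PulledBackConnection

variable {E F : Type*} [NormedAddCommGroup E] [NormedSpace ℝ E] [NormedAddCommGroup F]
  [NormedSpace ℝ F] {Φ : E → F} {G : F → F →L[ℝ] F →L[ℝ] F} {x : E}

/-- The Hessian `∇dΦ` of `Φ : E → F`, for the connection with Christoffel symbols `G` on the target
and the flat connection on the source. The pulled back connection has Christoffel symbol `u` at
`(h, k)` if `dΦ(u) = ∇dΦ(h, k)`. -/
def covariantHessian (Φ : E → F) (G : F → F →L[ℝ] F →L[ℝ] F) (x : E) : E →L[ℝ] E →L[ℝ] F :=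
  fderiv ℝ (fderiv ℝ Φ) x + (G (Φ x)).bilinearComp (fderiv ℝ Φ x) (fderiv ℝ Φ x)

/-- The curvature tensor `R(a, b)e` of the connection with Christoffel symbols `G`. -/
def chartCurvature (G : F → F →L[ℝ] F →L[ℝ] F) (y a b e : F) : F :=
  fderiv ℝ G y a b e - fderiv ℝ G y b a e + G y a (G y b e) - G y b (G y a e)

theorem covariantHessian_apply (h k : E) : covariantHessian Φ G x h k =
    fderiv ℝ (fderiv ℝ Φ) x h k + G (Φ x) (fderiv ℝ Φ x h) (fderiv ℝ Φ x k) := rfl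

theorem fderiv_fderiv_comm (hΦ : ContDiffAt ℝ ∞ Φ x) (h k : E) :
    fderiv ℝ (fderiv ℝ Φ) x h k = fderiv ℝ (fderiv ℝ Φ) x k h :=
  (hΦ.isSymmSndFDerivAt (by simpa using WithTop.coe_le_coe.2 (le_top : (2 : ℕ∞) ≤ ⊤))).eq h k

theorem covariantHessian_comm (hΦ : ContDiffAt ℝ ∞ Φ x)
    (hG : ∀ a b, G (Φ x) a b = G (Φ x) b a) (h k : E) :
    covariantHessian Φ G x h k = covariantHessian Φ G x k h := by
  rw [covariantHessian_apply, covariantHessian_apply, fderiv_fderiv_comm hΦ, hG]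

theorem contDiffAt_fderiv_infty (hΦ : ContDiffAt ℝ ∞ Φ x) : ContDiffAt ℝ ∞ (fderiv ℝ Φ) x :=
  hΦ.fderiv_right (by simp)

theorem contDiffAt_covariantHessian_apply {h k : E} (hΦ : ContDiffAt ℝ ∞ Φ x)
    (hG : ContDiffAt ℝ ∞ G (Φ x)) :
    ContDiffAt ℝ ∞ (fun p : E × E × E => covariantHessian Φ G p.1 p.2.1 p.2.2) (x, h, k) := by
  have hx : ContDiffAt ℝ ∞ (fun p : E × E × E => p.1) (x, h, k) := contDiffAt_fst
  have hh : ContDiffAt ℝ ∞ (fun p : E × E × E => p.2.1) (x, h, k) := contDiffAt_snd.fst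
  have hk : ContDiffAt ℝ ∞ (fun p : E × E × E => p.2.2) (x, h, k) := contDiffAt_snd.snd
  have hD := (contDiffAt_fderiv_infty hΦ).comp (x, h, k) hx
  have hD' := (contDiffAt_fderiv_infty (contDiffAt_fderiv_infty hΦ)).comp (x, h, k) hx
  have hGΦ := (hG.comp x hΦ).comp (x, h, k) hx
  exact ((hD'.clm_apply hh).clm_apply hk).add ((hGΦ.clm_apply (hD.clm_apply hh)).clm_apply
    (hD.clm_apply hk))

theorem hasDerivAt_fderiv_apply {X Y : ℝ → E} {m w : E} {t : ℝ} (hΦ : ContDiffAt ℝ ∞ Φ (X t))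
    (hX : HasDerivAt X m t) (hY : HasDerivAt Y w t) :
    HasDerivAt (fun s => fderiv ℝ Φ (X s) (Y s))
      (fderiv ℝ (fderiv ℝ Φ) (X t) m (Y t) + fderiv ℝ Φ (X t) w) t :=
  (((contDiffAt_fderiv_infty hΦ).differentiableAt (by simp)).hasFDerivAt.comp_hasDerivAt t
    hX).clm_apply hY

theorem differentiableAt_bilinearComp {B : E → F →L[ℝ] F →L[ℝ] F} {A : E → E →L[ℝ] F}
    (hB : DifferentiableAt ℝ B x) (hA : DifferentiableAt ℝ A x) :
    DifferentiableAt ℝ (fun z => (B z).bilinearComp (A z) (A z)) x := by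
  have hcomp : DifferentiableAt ℝ (fun z => (ContinuousLinearMap.compL ℝ E F F).flip (A z)) x :=
    DifferentiableAt.comp (F := E →L[ℝ] F) (G := (F →L[ℝ] F) →L[ℝ] E →L[ℝ] F) x
      (ContinuousLinearMap.differentiableAt (E := E →L[ℝ] F) (F := (F →L[ℝ] F) →L[ℝ] E →L[ℝ] F)
        (ContinuousLinearMap.compL ℝ E F F).flip) hA
  exact hcomp.clm_comp (hB.clm_comp hA)

theorem differentiableAt_covariantHessian (hΦ : ContDiffAt ℝ ∞ Φ x)
    (hG : DifferentiableAt ℝ G (Φ x)) : DifferentiableAt ℝ (covariantHessian Φ G) x := by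
  have hD := (contDiffAt_fderiv_infty hΦ).differentiableAt (by simp)
  have hD' := (contDiffAt_fderiv_infty (contDiffAt_fderiv_infty hΦ)).differentiableAt (by simp)
  have hGΦ : DifferentiableAt ℝ (fun z => G (Φ z)) x :=
    DifferentiableAt.comp (G := F →L[ℝ] F →L[ℝ] F) x hG (hΦ.differentiableAt (by simp))
  exact hD'.add (differentiableAt_bilinearComp hGΦ hD)

theorem fderiv_covariantHessian_apply (hΦ : ContDiffAt ℝ ∞ Φ x) (hG : DifferentiableAt ℝ G (Φ x))
    (m h k : E) : fderiv ℝ (covariantHessian Φ G) x m h k =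
      fderiv ℝ (fderiv ℝ (fderiv ℝ Φ)) x m h k
      + fderiv ℝ G (Φ x) (fderiv ℝ Φ x m) (fderiv ℝ Φ x h) (fderiv ℝ Φ x k)
      + G (Φ x) (fderiv ℝ (fderiv ℝ Φ) x m h) (fderiv ℝ Φ x k)
      + G (Φ x) (fderiv ℝ Φ x h) (fderiv ℝ (fderiv ℝ Φ) x m k) := by
  have hD := ((contDiffAt_fderiv_infty hΦ).differentiableAt (by simp)).hasFDerivAt
  have hD' := ((contDiffAt_fderiv_infty (contDiffAt_fderiv_infty hΦ)).differentiableAt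
    (by simp)).hasFDerivAt
  have hGΦ : HasFDerivAt (fun z => G (Φ z)) ((fderiv ℝ G (Φ x)).comp (fderiv ℝ Φ x)) x :=
    HasFDerivAt.comp (G := F →L[ℝ] F →L[ℝ] F) x hG.hasFDerivAt
      (hΦ.differentiableAt (by simp)).hasFDerivAt
  have happly (l : E) := hD.clm_apply (hasFDerivAt_const l x)
  have hright := ((hD'.clm_apply (hasFDerivAt_const h x)).clm_apply (hasFDerivAt_const k x)).add
    ((hGΦ.clm_apply (happly h)).clm_apply (happly k))
  have hleft := ((differentiableAt_covariantHessian hΦ hG).hasFDerivAt.clm_apply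
    (hasFDerivAt_const h x)).clm_apply (hasFDerivAt_const k x)
  have heq := congrArg (fun L : E →L[ℝ] F => L m) (hleft.unique hright)
  simp only [ContinuousLinearMap.comp_zero, zero_add, ContinuousLinearMap.flip_apply,
    ContinuousLinearMap.flip_add, add_apply, ContinuousLinearMap.comp_apply] at heq
  rw [heq]
  abel

theorem fderiv_apply_eq_of_eventually_eq_covariantHessian {X Y : ℝ → E} {m w h k : E} {t : ℝ}
    (hΦ : ContDiffAt ℝ ∞ Φ (X t)) (hG : DifferentiableAt ℝ G (Φ (X t)))
    (hX : HasDerivAt X m t) (hY : HasDerivAt Y w t)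
    (hXY : ∀ᶠ s in 𝓝 t, fderiv ℝ Φ (X s) (Y s) = covariantHessian Φ G (X s) h k) :
    fderiv ℝ Φ (X t) w =
      fderiv ℝ (covariantHessian Φ G) (X t) m h k - fderiv ℝ (fderiv ℝ Φ) (X t) m (Y t) := by
  have hcov : HasDerivAt (fun s => covariantHessian Φ G (X s))
      (fderiv ℝ (covariantHessian Φ G) (X t) m) t :=
    HasFDerivAt.comp_hasDerivAt (E := E →L[ℝ] E →L[ℝ] F) t
      (differentiableAt_covariantHessian hΦ hG).hasFDerivAt hX
  have happly : HasDerivAt (fun s => covariantHessian Φ G (X s) h k)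
      (fderiv ℝ (covariantHessian Φ G) (X t) m h k) t := by
    simpa using (hcov.clm_apply (hasDerivAt_const t h)).clm_apply (hasDerivAt_const t k)
  exact eq_sub_of_add_eq' ((hasDerivAt_fderiv_apply hΦ hX hY).unique
    (happly.congr_of_eventuallyEq hXY))

theorem hasDerivAt_metric_pullback {g : F → F →L[ℝ] F →L[ℝ] ℝ} {X : ℝ → E} {m u w h k : E} {t : ℝ}
    (hΦ : ContDiffAt ℝ ∞ Φ (X t)) (hg : DifferentiableAt ℝ g (Φ (X t)))
    (hgG : ∀ a b e, fderiv ℝ g (Φ (X t)) a b e =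
      g (Φ (X t)) (G (Φ (X t)) a b) e + g (Φ (X t)) b (G (Φ (X t)) a e))
    (hX : HasDerivAt X m t) (hu : fderiv ℝ Φ (X t) u = covariantHessian Φ G (X t) m h)
    (hw : fderiv ℝ Φ (X t) w = covariantHessian Φ G (X t) m k) :
    HasDerivAt (fun s => g (Φ (X s)) (fderiv ℝ Φ (X s) h) (fderiv ℝ Φ (X s) k))
      (g (Φ (X t)) (fderiv ℝ Φ (X t) u) (fderiv ℝ Φ (X t) k)
        + g (Φ (X t)) (fderiv ℝ Φ (X t) h) (fderiv ℝ Φ (X t) w)) t := by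
  have hgΦ : HasDerivAt (fun s => g (Φ (X s))) (fderiv ℝ g (Φ (X t)) (fderiv ℝ Φ (X t) m)) t :=
    HasFDerivAt.comp_hasDerivAt (E := F →L[ℝ] F →L[ℝ] ℝ) t hg.hasFDerivAt
      ((hΦ.differentiableAt (by simp)).hasFDerivAt.comp_hasDerivAt t hX)
  have happly (l : E) := hasDerivAt_fderiv_apply hΦ hX (hasDerivAt_const t l)
  refine ((hgΦ.clm_apply (happly h)).clm_apply (happly k)).congr_deriv ?_
  simp only [map_zero, add_zero, add_apply, map_add, hgG, hu, hw, covariantHessian_apply]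
  abel

theorem chartCurvature_fderiv_apply (hΦ : ContDiffAt ℝ ∞ Φ x) (hG : DifferentiableAt ℝ G (Φ x))
    (h k l : E) :
    fderiv ℝ (covariantHessian Φ G) x h k l - fderiv ℝ (covariantHessian Φ G) x k h l
        + G (Φ x) (fderiv ℝ Φ x h) (covariantHessian Φ G x k l)
        - G (Φ x) (fderiv ℝ Φ x k) (covariantHessian Φ G x h l) =
      chartCurvature G (Φ x) (fderiv ℝ Φ x h) (fderiv ℝ Φ x k) (fderiv ℝ Φ x l) := by
  have hsymm : fderiv ℝ (fderiv ℝ (fderiv ℝ Φ)) x h k = fderiv ℝ (fderiv ℝ (fderiv ℝ Φ)) x k h :=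
    fderiv_fderiv_comm (contDiffAt_fderiv_infty hΦ) h k
  simp only [fderiv_covariantHessian_apply hΦ hG, covariantHessian_apply, chartCurvature,
    hsymm, fderiv_fderiv_comm hΦ h k, map_add]
  abel

end PulledBackConnection

section HalfPlane

variable {y : ℝ × ℝ}

open ContinuousLinearMap in
/-- The Riemannian metric `dr² / r + dμ² / r³` on the half-plane of all `y = (r, μ)` with
`r > 0`. -/
def halfPlaneMetric (y : ℝ × ℝ) : ℝ × ℝ →L[ℝ] ℝ × ℝ →L[ℝ] ℝ :=
  y.1⁻¹ • (mul ℝ ℝ).bilinearComp (fst ℝ ℝ ℝ) (fst ℝ ℝ ℝ) +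
    (y.1 ^ 3)⁻¹ • (mul ℝ ℝ).bilinearComp (snd ℝ ℝ ℝ) (snd ℝ ℝ ℝ)

open ContinuousLinearMap in
/-- The Christoffel symbols of `halfPlaneMetric`. -/
def halfPlaneChristoffel (y : ℝ × ℝ) : ℝ × ℝ →L[ℝ] ℝ × ℝ →L[ℝ] ℝ × ℝ :=
  y.1⁻¹ • ((lsmul ℝ ℝ).bilinearComp (fst ℝ ℝ ℝ)
        ((-(1 / 2 : ℝ) • fst ℝ ℝ ℝ).prod (-(3 / 2 : ℝ) • snd ℝ ℝ ℝ)) +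
      (lsmul ℝ ℝ).bilinearComp (snd ℝ ℝ ℝ) ((0 : ℝ × ℝ →L[ℝ] ℝ).prod (-(3 / 2 : ℝ) • fst ℝ ℝ ℝ))) +
    (y.1 ^ 3)⁻¹ • (lsmul ℝ ℝ).bilinearComp (snd ℝ ℝ ℝ) (((3 / 2 : ℝ) • snd ℝ ℝ ℝ).prod 0)

theorem halfPlaneMetric_apply (y a b : ℝ × ℝ) :
    halfPlaneMetric y a b = a.1 * b.1 / y.1 + a.2 * b.2 / y.1 ^ 3 := by
  simp only [halfPlaneMetric, add_apply, smul_apply, ContinuousLinearMap.bilinearComp_apply,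
    ContinuousLinearMap.coe_fst', ContinuousLinearMap.coe_snd', ContinuousLinearMap.mul_apply',
    smul_eq_mul]
  ring

theorem halfPlaneChristoffel_apply (y a b : ℝ × ℝ) : halfPlaneChristoffel y a b =
    (-(a.1 * b.1) / (2 * y.1) + 3 * (a.2 * b.2) / (2 * y.1 ^ 3),
      -(3 * (a.1 * b.2 + a.2 * b.1)) / (2 * y.1)) := by
  ext <;> simp [halfPlaneChristoffel] <;> ring

theorem halfPlaneChristoffel_comm (y a b : ℝ × ℝ) :
    halfPlaneChristoffel y a b = halfPlaneChristoffel y b a := by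
  simp only [halfPlaneChristoffel_apply, mul_comm a.1, mul_comm a.2, add_comm]

section InvSMul

variable {E : Type*} [NormedAddCommGroup E] [NormedSpace ℝ E]

theorem contDiffAt_inv_smul_add_inv_pow_smul (hy : y.1 ≠ 0) (B C : E) :
    ContDiffAt ℝ ∞ (fun z : ℝ × ℝ => z.1⁻¹ • B + (z.1 ^ 3)⁻¹ • C) y :=
  ((contDiffAt_fst.inv hy).smul contDiffAt_const).add
    (((contDiffAt_fst.pow 3).inv (pow_ne_zero 3 hy)).smul contDiffAt_const)

theorem fderiv_inv_smul_add_inv_pow_smul_apply (hy : y.1 ≠ 0) (B C : E) (a : ℝ × ℝ) :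
    fderiv ℝ (fun z : ℝ × ℝ => z.1⁻¹ • B + (z.1 ^ 3)⁻¹ • C) y a =
      (-a.1 / y.1 ^ 2) • B + (-(3 * a.1) / y.1 ^ 4) • C := by
  have hfst : HasFDerivAt Prod.fst (ContinuousLinearMap.fst ℝ ℝ ℝ) y := hasFDerivAt_fst
  have hinv := (hasDerivAt_inv hy).comp_hasFDerivAt y hfst
  have hinv_pow := ((hasDerivAt_pow 3 y.1).inv (pow_ne_zero 3 hy)).comp_hasFDerivAt y hfst
  refine (congrArg (· a) ((hinv.smul_const B).add (hinv_pow.smul_const C)).fderiv).trans ?_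
  simp only [add_apply, ContinuousLinearMap.smulRight_apply,
    smul_apply, ContinuousLinearMap.coe_fst', smul_eq_mul]
  congr 2
  · ring
  · field_simp
    push_cast
    ring

end InvSMul

theorem contDiffAt_halfPlaneMetric (hy : y.1 ≠ 0) : ContDiffAt ℝ ∞ halfPlaneMetric y :=
  contDiffAt_inv_smul_add_inv_pow_smul (E := ℝ × ℝ →L[ℝ] ℝ × ℝ →L[ℝ] ℝ) hy _ _

theorem contDiffAt_halfPlaneChristoffel (hy : y.1 ≠ 0) :
    ContDiffAt ℝ ∞ halfPlaneChristoffel y :=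
  contDiffAt_inv_smul_add_inv_pow_smul (E := ℝ × ℝ →L[ℝ] ℝ × ℝ →L[ℝ] ℝ × ℝ) hy _ _

theorem fderiv_halfPlaneMetric_apply (hy : y.1 ≠ 0) (a b e : ℝ × ℝ) :
    fderiv ℝ halfPlaneMetric y a b e =
      -(a.1 * (b.1 * e.1)) / y.1 ^ 2 - 3 * a.1 * (b.2 * e.2) / y.1 ^ 4 := by
  have hderiv := fderiv_inv_smul_add_inv_pow_smul_apply (E := ℝ × ℝ →L[ℝ] ℝ × ℝ →L[ℝ] ℝ) hy
  refine (congrArg (fun L : ℝ × ℝ →L[ℝ] ℝ × ℝ →L[ℝ] ℝ => L b e) (hderiv _ _ a)).trans ?_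
  simp only [add_apply, smul_apply, ContinuousLinearMap.bilinearComp_apply,
    ContinuousLinearMap.coe_fst', ContinuousLinearMap.coe_snd', ContinuousLinearMap.mul_apply',
    smul_eq_mul]
  ring

theorem fderiv_halfPlaneChristoffel_apply (hy : y.1 ≠ 0) (a b e : ℝ × ℝ) :
    fderiv ℝ halfPlaneChristoffel y a b e =
      (a.1 * (b.1 * e.1) / (2 * y.1 ^ 2) - 9 * a.1 * (b.2 * e.2) / (2 * y.1 ^ 4),
        3 * a.1 * (b.1 * e.2 + b.2 * e.1) / (2 * y.1 ^ 2)) := by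
  have hderiv := fderiv_inv_smul_add_inv_pow_smul_apply (E := ℝ × ℝ →L[ℝ] ℝ × ℝ →L[ℝ] ℝ × ℝ) hy
  refine (congrArg (fun L : ℝ × ℝ →L[ℝ] ℝ × ℝ →L[ℝ] ℝ × ℝ => L b e) (hderiv _ _ a)).trans ?_
  ext <;> simp <;> ring

theorem fderiv_halfPlaneMetric_eq_christoffel (hy : y.1 ≠ 0) (a b e : ℝ × ℝ) :
    fderiv ℝ halfPlaneMetric y a b e = halfPlaneMetric y (halfPlaneChristoffel y a b) e +
      halfPlaneMetric y b (halfPlaneChristoffel y a e) := by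
  simp only [fderiv_halfPlaneMetric_apply hy, halfPlaneMetric_apply, halfPlaneChristoffel_apply]
  field_simp
  ring

/-- The area form of the metric is `dr ∧ dμ / r²`, so the Gauss curvature is `-3 / r`. -/
theorem halfPlaneMetric_chartCurvature (hy : y.1 ≠ 0) (a b : ℝ × ℝ) :
    halfPlaneMetric y (chartCurvature halfPlaneChristoffel y a b b) a =
      -3 * (a.1 * b.2 - b.1 * a.2) ^ 2 / y.1 ^ 5 := by
  simp only [chartCurvature, fderiv_halfPlaneChristoffel_apply hy, halfPlaneMetric_apply,
    halfPlaneChristoffel_apply, Prod.fst_sub, Prod.fst_add, Prod.snd_sub, Prod.snd_add]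
  field_simp
  ring

end HalfPlane

section ParametricPrimitive

variable {E : Type*} [NormedAddCommGroup E] [NormedSpace ℝ E] {f f' : ℝ → ℝ → E}

theorem hasDerivAt_intervalIntegral_of_continuous (hf : Continuous (Function.uncurry f))
    (hf' : Continuous (Function.uncurry f')) (hderiv : ∀ t s, HasDerivAt (f · s) (f' t s) t)
    (a b t : ℝ) : HasDerivAt (fun t => ∫ s in a..b, f t s) (∫ s in a..b, f' t s) t := by
  obtain ⟨C, hC⟩ := ((isCompact_Icc (a := t - 1) (b := t + 1)).prod
    (isCompact_uIcc (a := a) (b := b))).exists_bound_of_continuousOn hf'.continuousOn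
  refine (intervalIntegral.hasDerivAt_integral_of_dominated_loc_of_deriv_le (F := f) (F' := f')
    (bound := fun _ => C) (Icc_mem_nhds (sub_one_lt t) (lt_add_one t))
    (.of_forall fun x => ?_) ?_ ?_ ?_ ?_ ?_).2
  · exact (hf.comp (Continuous.prodMk_right x)).aestronglyMeasurable
  · exact (hf.comp (Continuous.prodMk_right t)).intervalIntegrable _ _
  · exact (hf'.comp (Continuous.prodMk_right t)).aestronglyMeasurable
  · exact .of_forall fun s hs x hx => hC (x, s) ⟨hx, Set.uIoc_subset_uIcc hs⟩
  · exact intervalIntegrable_const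
  · exact .of_forall fun s _ x _ => hderiv x s

theorem hasFDerivAt_parametric_primitive_of_continuous [CompleteSpace E]
    (hf : Continuous (Function.uncurry f)) (hf' : Continuous (Function.uncurry f'))
    (hderiv : ∀ t s, HasDerivAt (f · s) (f' t s) t) (a : ℝ) (p : ℝ × ℝ) :
    HasFDerivAt (fun q : ℝ × ℝ => ∫ s in a..q.2, f q.1 s)
      ((ContinuousLinearMap.toSpanSingleton ℝ (∫ s in a..p.2, f' p.1 s)).coprod
        (ContinuousLinearMap.toSpanSingleton ℝ (f p.1 p.2))) p := by
  have hspan : Continuous fun e : E => ContinuousLinearMap.toSpanSingleton ℝ e :=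
    ContinuousLinearMap.toSpanSingletonCLE.continuous
  refine (hasStrictFDerivAt_uncurry_coprod (f := fun t b => ∫ s in a..b, f t s)
    (f₁ := fun t b => ContinuousLinearMap.toSpanSingleton ℝ (∫ s in a..b, f' t s))
    (f₂ := fun t b => ContinuousLinearMap.toSpanSingleton ℝ (f t b))
    (.of_forall fun q => ?_) (.of_forall fun q => ?_) ?_ ?_).hasFDerivAt
  · exact (hasDerivAt_intervalIntegral_of_continuous hf hf' hderiv a q.2 q.1).hasFDerivAt
  · have hq : Continuous (f q.1) := hf.comp (Continuous.prodMk_right q.1)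
    exact (hq.integral_hasStrictDerivAt a q.2).hasDerivAt.hasFDerivAt
  · exact (hspan.comp
      (intervalIntegral.continuous_parametric_primitive_of_continuous hf')).continuousAt
  · exact (hspan.comp hf).continuousAt

end ParametricPrimitive

section Strip

variable {E : Type*} [NormedAddCommGroup E] [NormedSpace ℝ E] {a b : ℝ} {f : ℝ × ℝ → E}
  {p : ℝ × ℝ}

/-- The strip `ℝ × [a, b]`, on which families of maps on `[a, b]` depending on a time are
defined. -/
abbrev strip (a b : ℝ) : Set (ℝ × ℝ) := Set.univ ×ˢ Set.Icc a b

/-- The partial derivative in the time direction. -/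
def partialFst (f : ℝ × ℝ → E) (p : ℝ × ℝ) : E := deriv (fun t => f (t, p.2)) p.1

/-- The partial derivative in the direction of `[a, b]`, one-sided at the end points. -/
def partialSnd (a b : ℝ) (f : ℝ × ℝ → E) (p : ℝ × ℝ) : E :=
  derivWithin (fun x => f (p.1, x)) (Set.Icc a b) p.2

/-- The primitive in the direction of `[a, b]` that vanishes at `a`. -/
def primitiveSnd (a : ℝ) (f : ℝ × ℝ → E) (p : ℝ × ℝ) : E := ∫ s in a..p.2, f (p.1, s)

theorem mk_mem_strip (t : ℝ) {θ : ℝ} (hθ : θ ∈ Set.Icc a b) : (t, θ) ∈ strip a b :=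
  ⟨Set.mem_univ _, hθ⟩

theorem uniqueDiffOn_strip (hab : a < b) : UniqueDiffOn ℝ (strip a b) :=
  uniqueDiffOn_univ.prod (uniqueDiffOn_Icc hab)

theorem mem_closure_interior_strip (hab : a < b) (hp : p ∈ strip a b) :
    p ∈ closure (interior (strip a b)) := by
  rwa [interior_prod_eq, closure_prod_eq, interior_univ, closure_univ, interior_Icc,
    closure_Ioo hab.ne]

theorem hasDerivWithinAt_fderivWithin_strip (hf : ContDiffOn ℝ ∞ f (strip a b))
    (hp : p ∈ strip a b) :
    HasDerivWithinAt (fun x => f (p.1, x)) (fderivWithin ℝ f (strip a b) p (0, 1))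
      (Set.Icc a b) p.2 :=
  (hf.differentiableOn (by simp) p hp).hasFDerivWithinAt.comp_hasDerivWithinAt p.2
    ((hasDerivWithinAt_const p.2 _ p.1).prodMk (hasDerivWithinAt_id p.2 _))
    fun _ hx => mk_mem_strip p.1 hx

theorem hasDerivAt_fderivWithin_strip (hf : ContDiffOn ℝ ∞ f (strip a b)) (hp : p ∈ strip a b) :
    HasDerivAt (fun t => f (t, p.2)) (fderivWithin ℝ f (strip a b) p (1, 0)) p.1 :=
  hasDerivWithinAt_univ.1 <|
    (hf.differentiableOn (by simp) p hp).hasFDerivWithinAt.comp_hasDerivWithinAt p.1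
      ((hasDerivWithinAt_id p.1 _).prodMk (hasDerivWithinAt_const p.1 _ p.2))
      fun t _ => mk_mem_strip t hp.2

theorem partialFst_eq_fderivWithin (hf : ContDiffOn ℝ ∞ f (strip a b)) (hp : p ∈ strip a b) :
    partialFst f p = fderivWithin ℝ f (strip a b) p (1, 0) :=
  (hasDerivAt_fderivWithin_strip hf hp).deriv

theorem partialSnd_eq_fderivWithin (hab : a < b) (hf : ContDiffOn ℝ ∞ f (strip a b))
    (hp : p ∈ strip a b) : partialSnd a b f p = fderivWithin ℝ f (strip a b) p (0, 1) :=
  (hasDerivWithinAt_fderivWithin_strip hf hp).derivWithin (uniqueDiffOn_Icc hab _ hp.2)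

theorem hasDerivAt_partialFst (hf : ContDiffOn ℝ ∞ f (strip a b)) (hp : p ∈ strip a b) :
    HasDerivAt (fun t => f (t, p.2)) (partialFst f p) p.1 :=
  (hasDerivAt_fderivWithin_strip hf hp).differentiableAt.hasDerivAt

theorem contDiffOn_partialFst (hab : a < b) (hf : ContDiffOn ℝ ∞ f (strip a b)) :
    ContDiffOn ℝ ∞ (partialFst f) (strip a b) :=
  ((hf.fderivWithin (uniqueDiffOn_strip hab) (by simp)).clm_apply contDiffOn_const).congr
    fun _ hp => partialFst_eq_fderivWithin hf hp

theorem contDiffOn_partialSnd (hab : a < b) (hf : ContDiffOn ℝ ∞ f (strip a b)) :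
    ContDiffOn ℝ ∞ (partialSnd a b f) (strip a b) :=
  ((hf.fderivWithin (uniqueDiffOn_strip hab) (by simp)).clm_apply contDiffOn_const).congr
    fun _ hp => partialSnd_eq_fderivWithin hab hf hp

theorem fderivWithin_fderivWithin_apply {s : Set (ℝ × ℝ)} (hs : UniqueDiffOn ℝ s)
    (hf : ContDiffOn ℝ ∞ f s) (hp : p ∈ s) (v w : ℝ × ℝ) :
    fderivWithin ℝ (fun q => fderivWithin ℝ f s q v) s p w =
      fderivWithin ℝ (fderivWithin ℝ f s) s p w v := by
  have hd : DifferentiableWithinAt ℝ (fderivWithin ℝ f s) s p :=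
    (hf.fderivWithin (m := ∞) hs (by simp)).differentiableOn (by simp) p hp
  rw [(hd.hasFDerivWithinAt.clm_apply (hasFDerivWithinAt_const v p s)).fderivWithin (hs p hp)]
  simp

theorem partialSnd_partialFst (hab : a < b) (hf : ContDiffOn ℝ ∞ f (strip a b))
    (hp : p ∈ strip a b) :
    partialSnd a b (partialFst f) p = partialFst (partialSnd a b f) p := by
  have hsymm := (hf p hp).isSymmSndFDerivWithinAt
    (by simpa using WithTop.coe_le_coe.2 (le_top : (2 : ℕ∞) ≤ ⊤)) (uniqueDiffOn_strip hab)
    (mem_closure_interior_strip hab hp) hp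
  have hfst : Set.EqOn (partialFst f) _ (strip a b) := fun _ hq => partialFst_eq_fderivWithin hf hq
  have hsnd : Set.EqOn (partialSnd a b f) _ (strip a b) :=
    fun _ hq => partialSnd_eq_fderivWithin hab hf hq
  rw [partialSnd_eq_fderivWithin hab (contDiffOn_partialFst hab hf) hp,
    partialFst_eq_fderivWithin (contDiffOn_partialSnd hab hf) hp,
    fderivWithin_congr hfst (hfst hp), fderivWithin_congr hsnd (hsnd hp),
    fderivWithin_fderivWithin_apply (uniqueDiffOn_strip hab) hf hp,
    fderivWithin_fderivWithin_apply (uniqueDiffOn_strip hab) hf hp]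
  exact hsymm.eq _ _

theorem continuous_uncurry_projIcc {X : Type*} [TopologicalSpace X] {F : ℝ × ℝ → X} (hab : a ≤ b)
    (hF : ContinuousOn F (strip a b)) :
    Continuous (Function.uncurry fun t s => F (t, Set.projIcc a b hab s)) :=
  hF.comp_continuous (continuous_fst.prodMk (continuous_subtype_val.comp
    (continuous_projIcc.comp continuous_snd))) fun _ => mk_mem_strip _ (Subtype.coe_prop _)

theorem integral_projIcc (hab : a ≤ b) (hp : p ∈ strip a b) :
    ∫ s in a..p.2, f (p.1, Set.projIcc a b hab s) = primitiveSnd a f p := by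
  refine intervalIntegral.integral_congr fun s hs => ?_
  rw [Set.uIcc_of_le hp.2.1] at hs
  simp only [Set.projIcc_of_mem hab ⟨hs.1, hs.2.trans hp.2.2⟩]

theorem hasDerivAt_projIcc_partialFst (hab : a ≤ b) (hf : ContDiffOn ℝ ∞ f (strip a b)) (t s : ℝ) :
    HasDerivAt (fun t => f (t, Set.projIcc a b hab s))
      (partialFst f (t, Set.projIcc a b hab s)) t :=
  hasDerivAt_partialFst (p := (t, _)) hf (mk_mem_strip t (Set.projIcc a b hab s).2)

theorem hasDerivAt_integral_strip (hab : a < b) (hf : ContDiffOn ℝ ∞ f (strip a b)) (t : ℝ) :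
    HasDerivAt (fun t => ∫ s in a..b, f (t, s)) (∫ s in a..b, partialFst f (t, s)) t := by
  have hb (t : ℝ) : (t, b) ∈ strip a b := mk_mem_strip t (Set.right_mem_Icc.2 hab.le)
  have h := hasDerivAt_intervalIntegral_of_continuous
    (continuous_uncurry_projIcc hab.le hf.continuousOn)
    (continuous_uncurry_projIcc hab.le (contDiffOn_partialFst hab hf).continuousOn)
    (hasDerivAt_projIcc_partialFst hab.le hf) a b t
  simpa only [integral_projIcc hab.le (hb _), primitiveSnd] using h

variable [CompleteSpace E]

theorem hasFDerivWithinAt_primitiveSnd (hab : a < b) (hf : ContDiffOn ℝ ∞ f (strip a b))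
    (hp : p ∈ strip a b) :
    HasFDerivWithinAt (primitiveSnd a f)
      ((ContinuousLinearMap.toSpanSingleton ℝ (primitiveSnd a (partialFst f) p)).coprod
        (ContinuousLinearMap.toSpanSingleton ℝ (f p))) (strip a b) p := by
  have h := (hasFDerivAt_parametric_primitive_of_continuous
    (continuous_uncurry_projIcc hab.le hf.continuousOn)
    (continuous_uncurry_projIcc hab.le (contDiffOn_partialFst hab hf).continuousOn)
    (hasDerivAt_projIcc_partialFst hab.le hf) a p).hasFDerivWithinAt (s := strip a b)
  rw [integral_projIcc hab.le hp, Set.projIcc_of_mem _ hp.2] at h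
  exact h.congr (fun q hq => (integral_projIcc hab.le hq).symm) (integral_projIcc hab.le hp).symm

theorem contDiffOn_primitiveSnd (hab : a < b) (hf : ContDiffOn ℝ ∞ f (strip a b)) :
    ContDiffOn ℝ ∞ (primitiveSnd a f) (strip a b) := by
  refine contDiffOn_infty.2 fun n => ?_
  induction n generalizing f with
  | zero =>
    exact contDiffOn_zero.2 fun p hp =>
      (hasFDerivWithinAt_primitiveSnd hab hf hp).continuousWithinAt
  | succ n ih =>
    push_cast
    refine (contDiffOn_succ_iff_hasFDerivWithinAt_of_uniqueDiffOn (uniqueDiffOn_strip hab)).2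
      ⟨by simp, _, ?_, fun p hp => hasFDerivWithinAt_primitiveSnd hab hf hp⟩
    refine contDiffOn_clm_apply.2 fun y => ?_
    simp only [ContinuousLinearMap.coprod_apply, ContinuousLinearMap.toSpanSingleton_apply]
    exact ((ih (contDiffOn_partialFst hab hf)).const_smul y.1).add
      ((hf.of_le (mod_cast le_top)).const_smul y.2)

theorem partialSnd_primitiveSnd (hab : a < b) (hf : ContDiffOn ℝ ∞ f (strip a b))
    (hp : p ∈ strip a b) : partialSnd a b (primitiveSnd a f) p = f p := by
  rw [partialSnd_eq_fderivWithin hab (contDiffOn_primitiveSnd hab hf) hp,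
    (hasFDerivWithinAt_primitiveSnd hab hf hp).fderivWithin (uniqueDiffOn_strip hab p hp)]
  simp

end Strip

section Jets

/-- The first and second derivative of a plane curve at a parameter. -/
abbrev Jet : Type := Plane × Plane

theorem contDiffOn_dθ {f : ℝ → Plane} (hf : ContDiffOn ℝ ∞ f J) : ContDiffOn ℝ ∞ (dθ f) J :=
  hf.derivWithin uniqueDiffOn_J (by simp)

theorem hasDerivWithinAt_dθ {f : ℝ → Plane} (hf : ContDiffOn ℝ ∞ f J) {θ : ℝ} (hθ : θ ∈ J) :
    HasDerivWithinAt f (dθ f θ) J θ :=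
  (hf.differentiableOn (by simp) θ hθ).hasDerivWithinAt

theorem dθ_eq {f : ℝ → Plane} {f' : Plane} {θ : ℝ} (hθ : θ ∈ J)
    (hf : HasDerivWithinAt f f' J θ) : dθ f θ = f' :=
  hf.derivWithin (uniqueDiffOn_J θ hθ)

theorem dθ_congr {f g : ℝ → Plane} (h : Set.EqOn f g J) : Set.EqOn (dθ f) (dθ g) J :=
  fun _ hθ => derivWithin_congr h (h hθ)

theorem dθ_of_notMem (f : ℝ → Plane) {θ : ℝ} (hθ : θ ∉ J) : dθ f θ = 0 :=
  derivWithin_zero_of_notMem_closure (by rwa [closure_Icc])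

theorem dθ_add {f g : ℝ → Plane} (hf : ContDiffOn ℝ ∞ f J) (hg : ContDiffOn ℝ ∞ g J) :
    dθ (f + g) = dθ f + dθ g := by
  ext1 θ
  by_cases hθ : θ ∈ J
  · exact dθ_eq hθ ((hasDerivWithinAt_dθ hf hθ).add (hasDerivWithinAt_dθ hg hθ))
  · simp only [Pi.add_apply, dθ_of_notMem _ hθ, add_zero]

theorem dθ_smul (r : ℝ) (f : ℝ → Plane) : dθ (r • f) = r • dθ f :=
  funext fun _ => derivWithin_const_smul_field r f

theorem contDiffOn_toFun (h : V) : ContDiffOn ℝ ∞ (toFun h) J := h.2.1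

theorem toFun_zero_apply (h : V) : toFun h 0 = 0 := h.2.2.1

theorem dθ_toFun_zero (h : V) : dθ (toFun h) 0 1 = 0 := h.2.2.2

theorem eq_of_eqOn_toFun {h k : V} (hhk : Set.EqOn (toFun h) (toFun k) J) : h = k :=
  Subtype.ext (funext fun θ => by simpa [toFun, ext] using hhk θ.2)

theorem exists_toFun_eqOn {f : ℝ → Plane} (hf : ContDiffOn ℝ ∞ f J) (h0 : f 0 = 0)
    (h1 : dθ f 0 1 = 0) : ∃ h : V, Set.EqOn (toFun h) f J := by
  have hext : Set.EqOn (ext fun θ => f θ) f J := fun θ hθ => by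
    simp only [ext, Set.IccExtend_of_mem _ _ hθ]
  exact ⟨⟨fun θ => f θ, hf.congr hext, (hext zero_mem_J).trans h0, by
    rw [dθ_congr hext zero_mem_J, h1]⟩, hext⟩

/-- The first and second derivative of an element of `V`; the metric depends on a curve and its
variations only through them. -/
def jet : V →ₗ[ℝ] ℝ → Jet where
  toFun h θ := (dθ (toFun h) θ, dθ (dθ (toFun h)) θ)
  map_add' h k := by
    change (fun θ => (dθ (toFun h + toFun k) θ, dθ (dθ (toFun h + toFun k)) θ)) = _
    rw [dθ_add (contDiffOn_toFun h) (contDiffOn_toFun k),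
      dθ_add (contDiffOn_dθ (contDiffOn_toFun h)) (contDiffOn_dθ (contDiffOn_toFun k))]
    rfl
  map_smul' r h := by
    change (fun θ => (dθ (r • toFun h) θ, dθ (dθ (r • toFun h)) θ)) = _
    rw [dθ_smul, dθ_smul]
    rfl

theorem jet_add_smul_apply (h k : V) (r θ : ℝ) : jet (h + r • k) θ = jet h θ + r • jet k θ := by
  rw [map_add, map_smul, Pi.add_apply, Pi.smul_apply]

theorem jet_apply_of_notMem (h : V) {θ : ℝ} (hθ : θ ∉ J) : jet h θ = 0 :=
  Prod.ext (dθ_of_notMem _ hθ) (dθ_of_notMem _ hθ)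

theorem isSmoothCurve_const (h : V) : IsSmoothCurve fun _ => h :=
  (contDiffOn_toFun h).comp contDiffOn_snd fun _ hp => hp.2

theorem isSmoothCurve_add_smul {r : ℝ → ℝ} (hr : ContDiff ℝ ∞ r) (h k : V) :
    IsSmoothCurve fun t => h + r t • k :=
  (isSmoothCurve_const h).add ((hr.comp_contDiffOn contDiffOn_fst).smul (isSmoothCurve_const k))

theorem contDiffOn_jet_apply {γ : ℝ → V} (hγ : IsSmoothCurve γ) :
    ContDiffOn ℝ ∞ (fun p : ℝ × ℝ => jet (γ p.1) p.2) (strip 0 (2 * Real.pi)) := by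
  have h1 := contDiffOn_partialSnd Real.two_pi_pos hγ
  exact h1.prodMk (contDiffOn_partialSnd Real.two_pi_pos h1)

theorem contDiffOn_jet (h : V) : ContDiffOn ℝ ∞ (jet h) J :=
  (contDiffOn_jet_apply (isSmoothCurve_const h)).comp (contDiff_prodMk_right 0).contDiffOn
    fun _ hθ => mk_mem_strip 0 hθ

/-- The time derivative of a smooth curve in `V`, as a map on the strip. -/
abbrev velocityField (γ : ℝ → V) : ℝ × ℝ → Plane := partialFst fun p => toFun (γ p.1) p.2

theorem hasDerivAt_dθ_toFun {γ : ℝ → V} (hγ : IsSmoothCurve γ) (t : ℝ) {θ : ℝ} (hθ : θ ∈ J) :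
    HasDerivAt (fun s => dθ (toFun (γ s)) θ) (dθ (fun x => velocityField γ (t, x)) θ) t := by
  have h := hasDerivAt_partialFst (contDiffOn_partialSnd Real.two_pi_pos hγ) (mk_mem_strip t hθ)
  rwa [← partialSnd_partialFst Real.two_pi_pos hγ (mk_mem_strip t hθ)] at h

theorem hasDerivAt_dθ_dθ_toFun {γ : ℝ → V} (hγ : IsSmoothCurve γ) (t : ℝ) {θ : ℝ} (hθ : θ ∈ J) :
    HasDerivAt (fun s => dθ (dθ (toFun (γ s))) θ)
      (dθ (dθ fun x => velocityField γ (t, x)) θ) t := by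
  have h1 := contDiffOn_partialSnd Real.two_pi_pos hγ
  have h := hasDerivAt_partialFst (contDiffOn_partialSnd Real.two_pi_pos h1) (mk_mem_strip t hθ)
  rw [← partialSnd_partialFst Real.two_pi_pos h1 (mk_mem_strip t hθ)] at h
  exact h.congr_deriv (dθ_congr (fun x hx => (hasDerivAt_dθ_toFun hγ t hx).deriv) hθ)

theorem exists_toFun_eqOn_velocityField {γ : ℝ → V} (hγ : IsSmoothCurve γ) (t : ℝ) :
    ∃ η : V, Set.EqOn (toFun η) (fun θ => velocityField γ (t, θ)) J := by
  refine exists_toFun_eqOn ((contDiffOn_partialFst Real.two_pi_pos hγ).comp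
    (contDiff_prodMk_right t).contDiffOn fun θ hθ => mk_mem_strip t hθ) ?_ ?_
  · simp only [velocityField, partialFst, toFun_zero_apply, deriv_const]
  · have h : HasDerivAt (fun s => dθ (toFun (γ s)) 0 1) _ t :=
      (EuclideanSpace.proj (𝕜 := ℝ) (1 : Fin 2)).hasFDerivAt.comp_hasDerivAt t
        (hasDerivAt_dθ_toFun hγ t zero_mem_J)
    simp only [dθ_toFun_zero] at h
    exact h.unique (hasDerivAt_const t (0 : ℝ))

theorem exists_hasDerivAt_toFun_and_jet {γ : ℝ → V} (hγ : IsSmoothCurve γ) (t : ℝ) :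
    ∃ η : V, ∀ θ ∈ J, HasDerivAt (fun s => toFun (γ s) θ) (toFun η θ) t ∧
      HasDerivAt (fun s => jet (γ s) θ) (jet η θ) t := by
  obtain ⟨η, hη⟩ := exists_toFun_eqOn_velocityField hγ t
  refine ⟨η, fun θ hθ => ⟨?_, ?_⟩⟩
  · rw [hη hθ]
    exact hasDerivAt_partialFst hγ (mk_mem_strip t hθ)
  · have hη' := dθ_congr hη
    exact ((hasDerivAt_dθ_toFun hγ t hθ).congr_deriv (hη' hθ).symm).prodMk
      ((hasDerivAt_dθ_dθ_toFun hγ t hθ).congr_deriv (dθ_congr hη' hθ).symm)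

end Jets

section Invariants

/-- The rotation by `π / 2` as a continuous linear map. -/
def rotL : Plane →L[ℝ] Plane :=
  LinearMap.toContinuousLinearMap
    { toFun := rot
      map_add' := fun x y => by ext i; fin_cases i <;> simp [rot]; ring
      map_smul' := fun r x => by ext i; fin_cases i <;> simp [rot] }

theorem rotL_apply_zero (p : Plane) : rotL p 0 = -p 1 := rfl

theorem rotL_apply_one (p : Plane) : rotL p 1 = p 0 := rfl

theorem inner_eq (p q : Plane) : ⟪p, q⟫_ℝ = p 0 * q 0 + p 1 * q 1 := by
  simp [PiLp.inner_apply, Fin.sum_univ_two, mul_comm]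

theorem norm_sq_eq (p : Plane) : ‖p‖ ^ 2 = p 0 ^ 2 + p 1 ^ 2 := by
  rw [← real_inner_self_eq_norm_sq, inner_eq]; ring

theorem inner_rotL (p q : Plane) : ⟪rotL p, q⟫_ℝ = p 0 * q 1 - p 1 * q 0 := by
  rw [inner_eq, rotL_apply_zero, rotL_apply_one]
  ring

theorem hasDerivWithinAt_norm {E : Type*} [NormedAddCommGroup E] [InnerProductSpace ℝ E]
    {P : ℝ → E} {P' : E} {s : Set ℝ} {t : ℝ} (hP : HasDerivWithinAt P P' s t) (h0 : P t ≠ 0) :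
    HasDerivWithinAt (fun x => ‖P x‖) (⟪P t, P'⟫_ℝ / ‖P t‖) s t := by
  have h := hP.norm_sq.sqrt (pow_ne_zero 2 (norm_ne_zero_iff.2 h0))
  simp only [Real.sqrt_sq (norm_nonneg _)] at h
  exact h.congr_deriv (mul_div_mul_left _ _ two_ne_zero)

/-- The Euclidean invariants `(r, μ) = (|c'|, |c'| α')` of the jet of a curve `c` with turning
angle `α`, a point of the right half-plane if `c' ≠ 0`. -/
def curveInvariants (x : Jet) : ℝ × ℝ := (‖x.1‖, ⟪rotL x.1, x.2⟫_ℝ / ‖x.1‖)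

variable {x : Jet}

theorem curveInvariants_fst_ne_zero (h0 : x.1 ≠ 0) : (curveInvariants x).1 ≠ 0 :=
  norm_ne_zero_iff.2 h0

theorem contDiffAt_curveInvariants (h0 : x.1 ≠ 0) : ContDiffAt ℝ ∞ curveInvariants x := by
  have hn := contDiffAt_fst.norm ℝ (n := ∞) (x := x) h0
  exact hn.prodMk ((((rotL.contDiff.contDiffAt).comp x contDiffAt_fst).inner ℝ
    contDiffAt_snd).div hn (norm_ne_zero_iff.2 h0))

theorem fderiv_curveInvariants_apply (h0 : x.1 ≠ 0) (y : Jet) :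
    fderiv ℝ curveInvariants x y = (⟪x.1, y.1⟫_ℝ / ‖x.1‖,
      (⟪rotL y.1, x.2⟫_ℝ + ⟪rotL x.1, y.2⟫_ℝ) / ‖x.1‖ -
        ⟪rotL x.1, x.2⟫_ℝ * ⟪x.1, y.1⟫_ℝ / ‖x.1‖ ^ 3) := by
  obtain ⟨X, hX, rfl⟩ : ∃ X : ℝ → Jet, HasDerivAt X y 0 ∧ X 0 = x :=
    ⟨fun t => x + t • y, by simpa using ((hasDerivAt_id (0 : ℝ)).smul_const y).const_add x,
      by simp⟩
  have hn0 : ‖(X 0).1‖ ≠ 0 := norm_ne_zero_iff.2 h0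
  have hX1 : HasDerivAt (fun t => (X t).1) y.1 0 :=
    (ContinuousLinearMap.fst ℝ Plane Plane).hasFDerivAt.comp_hasDerivAt 0 hX
  have hX2 : HasDerivAt (fun t => (X t).2) y.2 0 :=
    (ContinuousLinearMap.snd ℝ Plane Plane).hasFDerivAt.comp_hasDerivAt 0 hX
  have hn := (hasDerivWithinAt_norm hX1.hasDerivWithinAt h0).hasDerivAt Filter.univ_mem
  have hcross := (rotL.hasFDerivAt.comp_hasDerivAt 0 hX1).inner ℝ hX2
  have hΦ := (contDiffAt_curveInvariants h0).differentiableAt (by simp)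
  refine (hΦ.hasFDerivAt.comp_hasDerivAt 0 hX).unique ((hn.prodMk (hcross.div hn hn0)).congr_deriv
    (Prod.ext rfl ?_))
  simp only [Function.comp_apply]
  field_simp
  ring

theorem fderiv_curveInvariants_frame (h0 : x.1 ≠ 0) (a a' b b' : ℝ) :
    fderiv ℝ curveInvariants x (a • x.1 + b • rotL x.1,
      (a • x.2 + a' • x.1) + (b • rotL x.2 + b' • rotL x.1)) =
      (a * (curveInvariants x).1, a * (curveInvariants x).2 + b' * (curveInvariants x).1) := by
  have hn : ‖x.1‖ ≠ 0 := norm_ne_zero_iff.2 h0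
  have h2 := norm_sq_eq x.1
  rw [fderiv_curveInvariants_apply h0]
  simp only [curveInvariants, map_add, map_smul, inner_eq, rotL_apply_zero, rotL_apply_one,
    PiLp.add_apply, PiLp.smul_apply, smul_eq_mul, Prod.mk.injEq]
  constructor
  · field_simp
    rw [h2]
    ring
  · field_simp
    rw [h2]
    ring

end Invariants

section Chart

/-- The global chart `c ↦ (|c'|, |c'| α')` of the manifold of curves, with values in the maps
from `[0, 2π]` to the right half-plane. -/
def chart (c : V) (θ : ℝ) : ℝ × ℝ := curveInvariants (jet c θ)

/-- The derivative of `chart` at `c`. -/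
def chartDeriv (c : V) : V →ₗ[ℝ] ℝ → ℝ × ℝ :=
  (LinearMap.pi fun θ =>
    (fderiv ℝ curveInvariants (jet c θ)).toLinearMap ∘ₗ LinearMap.proj θ) ∘ₗ jet

theorem chartDeriv_apply (c h : V) (θ : ℝ) :
    chartDeriv c h θ = fderiv ℝ curveInvariants (jet c θ) (jet h θ) := rfl

variable {c h : V} {θ : ℝ}

theorem fst_chartDeriv (hcθ : (jet c θ).1 ≠ 0) :
    (chartDeriv c h θ).1 = speed (toFun c) θ * tangentialPart (toFun c) (toFun h) θ := by
  have hn : speed (toFun c) θ ≠ 0 := norm_ne_zero_iff.2 hcθ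
  rw [chartDeriv_apply, fderiv_curveInvariants_apply hcθ, tangentialPart, unitTangent, Ds, Ds,
    real_inner_smul_left, real_inner_smul_right, real_inner_comm, ← mul_assoc, mul_inv_cancel₀ hn,
    one_mul, div_eq_inv_mul]
  rfl

theorem snd_chartDeriv (hθ : θ ∈ J) (hcθ : (jet c θ).1 ≠ 0) :
    (chartDeriv c h θ).2 = speed (toFun c) θ ^ 2 * normalPart (toFun c) (toFun h) θ := by
  have hn : ‖dθ (toFun c) θ‖ ≠ 0 := norm_ne_zero_iff.2 hcθ
  have hc' := hasDerivWithinAt_dθ (contDiffOn_dθ (contDiffOn_toFun c)) hθ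
  have hh' := hasDerivWithinAt_dθ (contDiffOn_dθ (contDiffOn_toFun h)) hθ
  have hDs : dθ (Ds (toFun c) (toFun h)) θ = _ :=
    dθ_eq hθ (((hasDerivWithinAt_norm hc' hcθ).inv hn).smul hh')
  have hnormal : normalPart (toFun c) (toFun h) θ = ⟪‖dθ (toFun c) θ‖⁻¹ •
    dθ (Ds (toFun c) (toFun h)) θ, rotL (‖dθ (toFun c) θ‖⁻¹ • dθ (toFun c) θ)⟫_ℝ := rfl
  have hn2 := norm_sq_eq (dθ (toFun c) θ)
  rw [chartDeriv_apply, fderiv_curveInvariants_apply hcθ, hnormal, hDs]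
  simp only [speed, jet, LinearMap.coe_mk, AddHom.coe_mk, inner_eq, rotL_apply_zero,
    rotL_apply_one, PiLp.smul_apply, PiLp.add_apply, smul_eq_mul, Pi.inv_apply]
  field_simp
  rw [hn2]
  ring

theorem chartDeriv_apply_of_frame {a b : ℝ → ℝ} {a' b' : ℝ} (hθ : θ ∈ J) (hcθ : (jet c θ).1 ≠ 0)
    (ha : HasDerivWithinAt a a' J θ) (hb : HasDerivWithinAt b b' J θ)
    (hh : Set.EqOn (dθ (toFun h))
      (fun x => a x • dθ (toFun c) x + b x • rotL (dθ (toFun c) x)) J) :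
    chartDeriv c h θ = (a θ * (chart c θ).1, a θ * (chart c θ).2 + b' * (chart c θ).1) := by
  have hc' := hasDerivWithinAt_dθ (contDiffOn_dθ (contDiffOn_toFun c)) hθ
  have hjet : jet h θ = (a θ • (jet c θ).1 + b θ • rotL (jet c θ).1,
      (a θ • (jet c θ).2 + a' • (jet c θ).1) + (b θ • rotL (jet c θ).2 + b' • rotL (jet c θ).1)) :=
    Prod.ext (hh hθ) ((dθ_congr hh hθ).trans (dθ_eq hθ ((ha.smul hc').add
      (hb.smul (rotL.hasFDerivAt.comp_hasDerivWithinAt θ hc')))))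
  rw [chartDeriv_apply, hjet, fderiv_curveInvariants_frame hcθ]
  rfl

theorem exists_isSmoothCurve_dθ_eq {g : ℝ × ℝ → Plane}
    (hg : ContDiffOn ℝ ∞ g (strip 0 (2 * Real.pi))) (hg0 : ∀ t, g (t, 0) 1 = 0) :
    ∃ η : ℝ → V, IsSmoothCurve η ∧
      ∀ t, Set.EqOn (dθ (toFun (η t))) (fun θ => g (t, θ)) J := by
  have hprim := contDiffOn_primitiveSnd Real.two_pi_pos hg
  have hdθ (t : ℝ) : Set.EqOn (dθ fun θ => primitiveSnd 0 g (t, θ)) (fun θ => g (t, θ)) J :=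
    fun θ hθ => partialSnd_primitiveSnd Real.two_pi_pos hg (mk_mem_strip t hθ)
  have hη (t : ℝ) : ∃ h : V, Set.EqOn (toFun h) (fun θ => primitiveSnd 0 g (t, θ)) J := by
    refine exists_toFun_eqOn (hprim.comp (contDiff_prodMk_right t).contDiffOn
      fun θ hθ => mk_mem_strip t hθ) intervalIntegral.integral_same ?_
    rw [hdθ t zero_mem_J, hg0]
  choose η hη using hη
  exact ⟨η, hprim.congr fun p hp => hη p.1 hp.2, fun t => (dθ_congr (hη t)).trans (hdθ t)⟩

theorem contDiffOn_chart {γ : ℝ → V} (hγ : IsSmoothCurve γ)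
    (hγM : ∀ t, γ t ∈ curvesModMot) :
    ContDiffOn ℝ ∞ (fun p : ℝ × ℝ => chart (γ p.1) p.2) (strip 0 (2 * Real.pi)) := fun p hp =>
  (contDiffAt_curveInvariants ((hγM p.1).1 p.2 hp.2)).comp_contDiffWithinAt p
    (contDiffOn_jet_apply hγ p hp)

theorem exists_isSmoothCurve_chartDeriv_eq {γ : ℝ → V} (hγ : IsSmoothCurve γ)
    (hγM : ∀ t, γ t ∈ curvesModMot) {e : ℝ × ℝ → ℝ × ℝ}
    (he : ContDiffOn ℝ ∞ e (strip 0 (2 * Real.pi))) :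
    ∃ η : ℝ → V, IsSmoothCurve η ∧
      ∀ t, Set.EqOn (chartDeriv (γ t) (η t)) (fun θ => e (t, θ)) J := by
  have hX := contDiffOn_jet_apply hγ
  have hΦ := contDiffOn_chart hγ hγM
  have hr : ∀ p ∈ strip 0 (2 * Real.pi), (chart (γ p.1) p.2).1 ≠ 0 := fun p hp =>
    curveInvariants_fst_ne_zero ((hγM p.1).1 p.2 hp.2)
  set a : ℝ × ℝ → ℝ := fun p => (e p).1 / (chart (γ p.1) p.2).1
  set b' : ℝ × ℝ → ℝ := fun p =>
    ((e p).2 - a p * (chart (γ p.1) p.2).2) / (chart (γ p.1) p.2).1 with hb'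
  have has : ContDiffOn ℝ ∞ a (strip 0 (2 * Real.pi)) := he.fst.div hΦ.fst hr
  have hbs' : ContDiffOn ℝ ∞ b' (strip 0 (2 * Real.pi)) :=
    (he.snd.sub (has.mul hΦ.snd)).div hΦ.fst hr
  have hbs := contDiffOn_primitiveSnd Real.two_pi_pos hbs'
  obtain ⟨η, hη, hdη⟩ := exists_isSmoothCurve_dθ_eq
    ((has.smul hX.fst).add (hbs.smul (rotL.contDiff.comp_contDiffOn hX.fst))) fun t => by
      have h0 : (jet (γ t) 0).1 1 = 0 := dθ_toFun_zero (γ t)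
      simp [primitiveSnd, h0]
  refine ⟨η, hη, fun t θ hθ => ?_⟩
  have hp := mk_mem_strip t hθ
  have hsnd {f : ℝ × ℝ → ℝ} (hf : ContDiffOn ℝ ∞ f (strip 0 (2 * Real.pi))) :
      HasDerivWithinAt (fun x => f (t, x)) (partialSnd 0 (2 * Real.pi) f (t, θ)) J θ :=
    (hasDerivWithinAt_fderivWithin_strip hf hp).differentiableWithinAt.hasDerivWithinAt
  rw [chartDeriv_apply_of_frame hθ ((hγM t).1 θ hθ) (hsnd has) (hsnd hbs) (hdη t),
    partialSnd_primitiveSnd Real.two_pi_pos hbs' hp]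
  have hrp := hr _ hp
  exact Prod.ext (div_mul_cancel₀ _ hrp) (by simp only [hb', div_mul_cancel₀ _ hrp]; ring)

theorem eq_smul_add_smul_rotL {p : Plane} (hp : p ≠ 0) (u : Plane) :
    u = (⟪p, u⟫_ℝ / ‖p‖ ^ 2) • p + (⟪rotL p, u⟫_ℝ / ‖p‖ ^ 2) • rotL p := by
  have hn : p 0 ^ 2 + p 1 ^ 2 ≠ 0 := by
    rw [← norm_sq_eq]; exact pow_ne_zero 2 (norm_ne_zero_iff.2 hp)
  ext i
  fin_cases i <;> simp [rotL_apply_zero, rotL_apply_one, inner_eq, norm_sq_eq] <;> field_simp <;>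
    ring

theorem eq_zero_of_dθ_eq_zero (hh : Set.EqOn (dθ (toFun h)) 0 J) : h = 0 := by
  refine eq_of_eqOn_toFun fun θ hθ => ?_
  rw [constant_of_derivWithin_zero ((contDiffOn_toFun h).differentiableOn (by simp))
    (fun x hx => hh (Set.Ico_subset_Icc_self hx)) θ hθ, toFun_zero_apply]
  rfl

theorem chartDeriv_injective (hc : c ∈ curvesModMot) : Function.Injective (chartDeriv c) := by
  refine (injective_iff_map_eq_zero _).2 fun h hh => eq_zero_of_dθ_eq_zero ?_
  have hc' := contDiffOn_dθ (contDiffOn_toFun c)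
  have hh' := contDiffOn_dθ (contDiffOn_toFun h)
  set b : ℝ → ℝ := fun θ =>
    ⟪rotL (dθ (toFun c) θ), dθ (toFun h) θ⟫_ℝ / ‖dθ (toFun c) θ‖ ^ 2 with hb
  have hbs : ContDiffOn ℝ ∞ b J := ((rotL.contDiff.comp_contDiffOn hc').inner ℝ hh').div
    ((hc'.norm ℝ hc.1).pow 2) fun θ hθ => pow_ne_zero 2 (norm_ne_zero_iff.2 (hc.1 θ hθ))
  have hframe : Set.EqOn (dθ (toFun h))
      (fun θ => (0 : ℝ) • dθ (toFun c) θ + b θ • rotL (dθ (toFun c) θ)) J := fun θ hθ => by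
    have hT : ⟪dθ (toFun c) θ, dθ (toFun h) θ⟫_ℝ = 0 := by
      have h0 := congrArg Prod.fst (congrFun hh θ)
      rw [chartDeriv_apply, fderiv_curveInvariants_apply (hc.1 θ hθ)] at h0
      exact (div_eq_zero_iff.1 h0).resolve_right (norm_ne_zero_iff.2 (hc.1 θ hθ))
    simpa [hT] using eq_smul_add_smul_rotL (hc.1 θ hθ) (dθ (toFun h) θ)
  have hb' : ∀ θ ∈ J, derivWithin b J θ = 0 := fun θ hθ => by
    have h := chartDeriv_apply_of_frame hθ (hc.1 θ hθ) (hasDerivWithinAt_const θ J (0 : ℝ))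
      (hbs.differentiableOn (by simp) θ hθ).hasDerivWithinAt hframe
    rw [hh, Pi.zero_apply, zero_mul, zero_mul, zero_add] at h
    exact (mul_eq_zero.1 (congrArg Prod.snd h).symm).resolve_right
      (curveInvariants_fst_ne_zero (hc.1 θ hθ))
  have hb0 : ∀ θ ∈ J, b θ = 0 := fun θ hθ => by
    rw [constant_of_derivWithin_zero (hbs.differentiableOn (by simp))
      (fun x hx => hb' x (Set.Ico_subset_Icc_self hx)) θ hθ]
    simp [hb, inner_rotL, dθ_toFun_zero]
  intro θ hθ
  simpa [hb0 θ hθ] using hframe hθ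

theorem eq_of_eqOn_chartDeriv {h k : V} (hc : c ∈ curvesModMot)
    (hhk : Set.EqOn (chartDeriv c h) (chartDeriv c k) J) : h = k := by
  refine chartDeriv_injective hc (funext fun θ => ?_)
  by_cases hθ : θ ∈ J
  · exact hhk hθ
  · simp only [chartDeriv_apply, jet_apply_of_notMem _ hθ]

end Chart

section Metric

variable {c : V}

theorem metric_eq_integral (hc : c ∈ curvesModMot) (h k : V) :
    metric (toFun c) (toFun h) (toFun k) = ∫ θ in (0 : ℝ)..(2 * Real.pi),
      halfPlaneMetric (chart c θ) (chartDeriv c h θ) (chartDeriv c k θ) := by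
  refine intervalIntegral.integral_congr fun θ hθ => ?_
  rw [Set.uIcc_of_le Real.two_pi_pos.le] at hθ
  have hn : speed (toFun c) θ ≠ 0 := norm_ne_zero_iff.2 (hc.1 θ hθ)
  have hr : (chart c θ).1 = speed (toFun c) θ := rfl
  simp only [halfPlaneMetric_apply, fst_chartDeriv (hc.1 θ hθ), snd_chartDeriv hθ (hc.1 θ hθ), hr]
  field_simp

theorem contDiffOn_chartDeriv {γ η : ℝ → V} (hγ : IsSmoothCurve γ) (hη : IsSmoothCurve η)
    (hγM : ∀ t, γ t ∈ curvesModMot) :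
    ContDiffOn ℝ ∞ (fun p : ℝ × ℝ => chartDeriv (γ p.1) (η p.1) p.2) (strip 0 (2 * Real.pi)) :=
  fun p hp => ((contDiffAt_fderiv_infty (contDiffAt_curveInvariants
    ((hγM p.1).1 p.2 hp.2))).comp_contDiffWithinAt p (contDiffOn_jet_apply hγ p hp)).clm_apply
      (contDiffOn_jet_apply hη p hp)

theorem contDiffOn_metricDensity {γ η ζ : ℝ → V} (hγ : IsSmoothCurve γ) (hη : IsSmoothCurve η)
    (hζ : IsSmoothCurve ζ) (hγM : ∀ t, γ t ∈ curvesModMot) :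
    ContDiffOn ℝ ∞ (fun p : ℝ × ℝ => halfPlaneMetric (chart (γ p.1) p.2)
      (chartDeriv (γ p.1) (η p.1) p.2) (chartDeriv (γ p.1) (ζ p.1) p.2))
      (strip 0 (2 * Real.pi)) := fun p hp => by
  have hmetric := ContDiffAt.comp_contDiffWithinAt (G := ℝ × ℝ →L[ℝ] ℝ × ℝ →L[ℝ] ℝ) p
    (contDiffAt_halfPlaneMetric (curveInvariants_fst_ne_zero ((hγM p.1).1 p.2 hp.2)))
    (contDiffOn_chart hγ hγM p hp)
  exact (hmetric.clm_apply (contDiffOn_chartDeriv hγ hη hγM p hp)).clm_apply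
    (contDiffOn_chartDeriv hγ hζ hγM p hp)

theorem continuousOn_metricDensity (hc : c ∈ curvesModMot) (h k : V) : ContinuousOn
    (fun θ => halfPlaneMetric (chart c θ) (chartDeriv c h θ) (chartDeriv c k θ)) J :=
  ((contDiffOn_metricDensity (isSmoothCurve_const c) (isSmoothCurve_const h)
    (isSmoothCurve_const k) fun _ => hc).comp (contDiff_prodMk_right 0).contDiffOn
      fun _ hθ => mk_mem_strip 0 hθ).continuousOn

theorem intervalIntegrable_metricDensity (hc : c ∈ curvesModMot) (h k : V) : IntervalIntegrable
    (fun θ => halfPlaneMetric (chart c θ) (chartDeriv c h θ) (chartDeriv c k θ))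
    MeasureTheory.volume 0 (2 * Real.pi) :=
  (continuousOn_metricDensity hc h k).intervalIntegrable_of_Icc Real.two_pi_pos.le

theorem metric_comm (c h k : ℝ → Plane) : metric c h k = metric c k h := by
  simp only [metric, mul_comm]

theorem metric_add_left (hc : c ∈ curvesModMot) (h k l : V) :
    metric (toFun c) (toFun (h + k)) (toFun l) =
      metric (toFun c) (toFun h) (toFun l) + metric (toFun c) (toFun k) (toFun l) := by
  simp only [metric_eq_integral hc, map_add, Pi.add_apply, add_apply]
  exact intervalIntegral.integral_add (intervalIntegrable_metricDensity hc h l)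
    (intervalIntegrable_metricDensity hc k l)

theorem metric_smul_left (hc : c ∈ curvesModMot) (r : ℝ) (h l : V) :
    metric (toFun c) (toFun (r • h)) (toFun l) = r • metric (toFun c) (toFun h) (toFun l) := by
  simp only [metric_eq_integral hc, map_smul, Pi.smul_apply, smul_apply,
    intervalIntegral.integral_smul]

/-- The Riemannian metric at a point `c` of the manifold, as a bilinear form on the tangent
space. -/
def metricForm (hc : c ∈ curvesModMot) : LinearMap.BilinForm ℝ V :=
  LinearMap.mk₂ ℝ (fun h k => metric (toFun c) (toFun h) (toFun k)) (metric_add_left hc)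
    (metric_smul_left hc)
    (fun h k l => by simp only [metric_comm _ (toFun h), metric_add_left hc])
    (fun r h k => by simp only [metric_comm _ (toFun h), metric_smul_left hc])

theorem metricForm_apply (hc : c ∈ curvesModMot) (h k : V) :
    metricForm hc h k = metric (toFun c) (toFun h) (toFun k) := rfl

theorem isSymm_metricForm (hc : c ∈ curvesModMot) : LinearMap.IsSymm (metricForm hc) :=
  ⟨fun _ _ => metric_comm _ _ _⟩

theorem halfPlaneMetric_self_pos {y a : ℝ × ℝ} (hy : 0 < y.1) (ha : a ≠ 0) :
    0 < halfPlaneMetric y a a := by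
  rw [halfPlaneMetric_apply]
  by_cases h1 : a.1 = 0
  · have h2 : a.2 ≠ 0 := fun h2 => ha (Prod.ext h1 h2)
    have := mul_self_pos.2 h2
    positivity
  · have := mul_self_pos.2 h1
    have := mul_self_nonneg a.2
    positivity

theorem halfPlaneMetric_self_nonneg {y : ℝ × ℝ} (hy : 0 ≤ y.1) (a : ℝ × ℝ) :
    0 ≤ halfPlaneMetric y a a := by
  rw [halfPlaneMetric_apply]
  have := mul_self_nonneg a.1
  have := mul_self_nonneg a.2
  positivity

theorem exists_chartDeriv_ne_zero (hc : c ∈ curvesModMot) {h : V} (hh : h ≠ 0) :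
    ∃ θ ∈ J, chartDeriv c h θ ≠ 0 := by
  by_contra! hzero
  exact hh (eq_of_eqOn_chartDeriv hc fun θ hθ => by rw [hzero θ hθ, map_zero, Pi.zero_apply])

theorem metricForm_self_pos (hc : c ∈ curvesModMot) {h : V} (hh : h ≠ 0) :
    0 < metricForm hc h h := by
  rw [metricForm_apply, metric_eq_integral hc]
  obtain ⟨θ, hθ, hne⟩ := exists_chartDeriv_ne_zero hc hh
  exact intervalIntegral.integral_pos Real.two_pi_pos (continuousOn_metricDensity hc h h)
    (fun _ _ => halfPlaneMetric_self_nonneg (norm_nonneg _) _)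
    ⟨θ, hθ, halfPlaneMetric_self_pos (norm_pos_iff.2 (hc.1 θ hθ)) hne⟩

theorem gram_pos (hc : c ∈ curvesModMot) {h k : V} (hi : LinearIndependent ℝ ![h, k]) :
    0 < gram c h k :=
  sub_pos.2 ((LinearMap.BilinForm.apply_sq_lt_iff_linearIndependent_of_symm (metricForm hc)
    (fun _ hh => metricForm_self_pos hc hh) (isSymm_metricForm hc) h k).2 hi)

end Metric

section Openness

theorem eventually_forall_add_smul_ne_zero {X E : Type*} [TopologicalSpace X]
    [NormedAddCommGroup E] [NormedSpace ℝ E] {K : Set X} {f g : X → E} (hK : IsCompact K)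
    (hf : ContinuousOn f K) (hg : ContinuousOn g K) (h0 : ∀ x ∈ K, f x ≠ 0) :
    ∀ᶠ t in 𝓝 (0 : ℝ), ∀ x ∈ K, f x + t • g x ≠ 0 := by
  have hcont : Continuous fun p : ℝ × K => f p.2 + p.1 • g p.2 :=
    (hf.domRestrict.comp continuous_snd).add
        (continuous_fst.smul (hg.domRestrict.comp continuous_snd))
  have hne := (isCompact_iff_isCompact_univ.1 hK).eventually_forall_of_forall_eventually
    (x₀ := (0 : ℝ)) (P := fun t x => f x + t • g x ≠ 0) fun x _ =>
      hcont.continuousAt.eventually_ne (by simpa using h0 x x.2)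
  exact hne.mono fun t ht x hx => ht ⟨x, hx⟩ (Set.mem_univ _)

theorem inv_norm_smul_eq_iff {p : Plane} (hp : p 1 = 0) : ‖p‖⁻¹ • p = !₂[1, 0] ↔ 0 < p 0 := by
  have hn : ‖p‖ = |p 0| := by
    rw [← sq_eq_sq₀ (norm_nonneg _) (abs_nonneg _), norm_sq_eq, hp, sq_abs]
    ring
  constructor
  · intro h
    have h0 : |p 0|⁻¹ * p 0 = 1 := by simpa [hn] using congrArg (fun q : Plane => q 0) h
    exact pos_of_mul_pos_right (h0 ▸ one_pos) (inv_nonneg.2 (abs_nonneg _))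
  · intro h
    ext i
    fin_cases i <;> simp [hn, hp, abs_of_pos h, h.ne']

theorem mem_curvesModMot_iff {c : V} :
    c ∈ curvesModMot ↔ (∀ θ ∈ J, (jet c θ).1 ≠ 0) ∧ 0 < (jet c 0).1 0 :=
  and_congr_right' (inv_norm_smul_eq_iff (dθ_toFun_zero c))

variable {c : V}

theorem eventually_add_smul_mem (hc : c ∈ curvesModMot) (m : V) :
    ∀ᶠ t in 𝓝 (0 : ℝ), c + t • m ∈ curvesModMot := by
  simp only [mem_curvesModMot_iff, jet_add_smul_apply] at hc ⊢
  refine (eventually_forall_add_smul_ne_zero isCompact_Icc (contDiffOn_jet c).continuousOn.fst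
    (contDiffOn_jet m).continuousOn.fst hc.1).and ?_
  have hcont : Continuous fun t : ℝ => (jet c 0).1 0 + t * (jet m 0).1 0 := by fun_prop
  exact hcont.continuousAt.eventually (lt_mem_nhds (by simpa using hc.2))

theorem exists_isSmoothCurve_eventually_eq_add_smul (hc : c ∈ curvesModMot) (m : V) :
    ∃ γ : ℝ → V, IsSmoothCurve γ ∧ (∀ t, γ t ∈ curvesModMot) ∧
      ∀ᶠ t in 𝓝 (0 : ℝ), γ t = c + t • m := by
  obtain ⟨ε, hε, hM⟩ := Metric.eventually_nhds_iff.1 (eventually_add_smul_mem hc m)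
  let φ : ContDiffBump (0 : ℝ) := ⟨ε / 2, ε, by positivity, by linarith⟩
  refine ⟨fun t => c + (t * φ t) • m, isSmoothCurve_add_smul (contDiff_id.mul φ.contDiff) c m,
    fun t => hM ?_, ?_⟩
  · rw [dist_zero_right, norm_mul, Real.norm_of_nonneg φ.nonneg]
    rcases lt_or_ge ‖t‖ ε with ht | ht
    · exact (mul_le_of_le_one_right (norm_nonneg t) φ.le_one).trans_lt ht
    · rwa [φ.zero_of_le_dist (by simpa using ht), mul_zero]
  · filter_upwards [φ.eventuallyEq_one] with t ht
    rw [ht, Pi.one_apply, mul_one]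

theorem hasDerivAt_jet_of_eventually_eq_add_smul {γ : ℝ → V} {m : V}
    (hγ : ∀ᶠ t in 𝓝 (0 : ℝ), γ t = c + t • m) (θ : ℝ) :
    HasDerivAt (fun t => jet (γ t) θ) (jet m θ) 0 := by
  have hline := ((hasDerivAt_id (0 : ℝ)).smul_const (jet m θ)).const_add (jet c θ)
  rw [one_smul] at hline
  exact hline.congr_of_eventuallyEq (hγ.mono fun t ht => by
    simp only [ht, jet_add_smul_apply, id])

end Openness

section LeviCivita

variable {c : V}

/-- The Hessian of the chart at `c`, for the half-plane connection on the target. -/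
def chartHessian (c : V) : V →ₗ[ℝ] V →ₗ[ℝ] ℝ → ℝ × ℝ :=
  LinearMap.mk₂ ℝ
    (fun h k θ => covariantHessian curveInvariants halfPlaneChristoffel (jet c θ) (jet h θ)
      (jet k θ))
    (fun h h' k => by ext1 θ; simp only [map_add, Pi.add_apply, add_apply])
    (fun r h k => by ext1 θ; simp only [map_smul, Pi.smul_apply, smul_apply])
    (fun h k k' => by ext1 θ; simp only [map_add, Pi.add_apply])
    (fun r h k => by ext1 θ; simp only [map_smul, Pi.smul_apply])

theorem chartHessian_apply (c h k : V) (θ : ℝ) : chartHessian c h k θ =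
    covariantHessian curveInvariants halfPlaneChristoffel (jet c θ) (jet h θ) (jet k θ) := rfl

theorem chartHessian_comm (hc : c ∈ curvesModMot) (h k : V) :
    chartHessian c h k = chartHessian c k h := by
  ext1 θ
  by_cases hθ : θ ∈ J
  · exact covariantHessian_comm (contDiffAt_curveInvariants (hc.1 θ hθ))
      (halfPlaneChristoffel_comm _) _ _
  · simp only [chartHessian_apply, jet_apply_of_notMem _ hθ]

theorem contDiffOn_chartHessian {γ η ζ : ℝ → V} (hγ : IsSmoothCurve γ) (hη : IsSmoothCurve η)
    (hζ : IsSmoothCurve ζ) (hγM : ∀ t, γ t ∈ curvesModMot) :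
    ContDiffOn ℝ ∞ (fun p : ℝ × ℝ => chartHessian (γ p.1) (η p.1) (ζ p.1) p.2)
      (strip 0 (2 * Real.pi)) := fun p hp => by
  have h0 := (hγM p.1).1 p.2 hp.2
  exact (contDiffAt_covariantHessian_apply (contDiffAt_curveInvariants h0)
    (contDiffAt_halfPlaneChristoffel (curveInvariants_fst_ne_zero h0))).comp_contDiffWithinAt p
      ((contDiffOn_jet_apply hγ p hp).prodMk ((contDiffOn_jet_apply hη p hp).prodMk
        (contDiffOn_jet_apply hζ p hp)))

theorem exists_isSmoothCurve_chartDeriv_eq_chartHessian {γ η ζ : ℝ → V} (hγ : IsSmoothCurve γ)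
    (hη : IsSmoothCurve η) (hζ : IsSmoothCurve ζ) (hγM : ∀ t, γ t ∈ curvesModMot) :
    ∃ ξ : ℝ → V, IsSmoothCurve ξ ∧
      ∀ t, chartDeriv (γ t) (ξ t) = chartHessian (γ t) (η t) (ζ t) := by
  obtain ⟨ξ, hξ, hξγ⟩ :=
    exists_isSmoothCurve_chartDeriv_eq hγ hγM (contDiffOn_chartHessian hγ hη hζ hγM)
  refine ⟨ξ, hξ, fun t => funext fun θ => ?_⟩
  by_cases hθ : θ ∈ J
  · exact hξγ t hθ
  · simp only [chartDeriv_apply, chartHessian_apply, jet_apply_of_notMem _ hθ, map_zero]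

/-- `Γ` is the pull back under the chart of the half-plane connection. -/
def IsChartConnection (Γ : V → V →ₗ[ℝ] V →ₗ[ℝ] V) : Prop :=
  ∀ c ∈ curvesModMot, ∀ h k, chartDeriv c (Γ c h k) = chartHessian c h k

theorem exists_isChartConnection : ∃ Γ, IsChartConnection Γ := by
  have hex (c : V) : ∃ Γ : V →ₗ[ℝ] V →ₗ[ℝ] V, c ∈ curvesModMot →
      ∀ h k, chartDeriv c (Γ h k) = chartHessian c h k := by
    by_cases hc : c ∈ curvesModMot
    · obtain ⟨L, hL⟩ := (chartDeriv c).exists_leftInverse_of_injective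
        (LinearMap.ker_eq_bot.2 (chartDeriv_injective hc))
      refine ⟨(chartHessian c).compr₂ L, fun _ h k => ?_⟩
      obtain ⟨ξ, -, hξ⟩ := exists_isSmoothCurve_chartDeriv_eq_chartHessian
        (isSmoothCurve_const c) (isSmoothCurve_const h) (isSmoothCurve_const k) fun _ => hc
      rw [LinearMap.compr₂_apply, ← hξ 0]
      exact congrArg _ (LinearMap.congr_fun hL (ξ 0))
    · exact ⟨0, fun h => absurd h hc⟩
  choose Γ hΓ using hex
  exact ⟨Γ, hΓ⟩

theorem hasDerivAt_metric {m h k u w : V} (hc : c ∈ curvesModMot)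
    (hu : chartDeriv c u = chartHessian c m h) (hw : chartDeriv c w = chartHessian c m k) :
    HasDerivAt (fun t : ℝ => metric (toFun (c + t • m)) (toFun h) (toFun k))
      (metric (toFun c) (toFun u) (toFun k) + metric (toFun c) (toFun h) (toFun w)) 0 := by
  obtain ⟨γ, hγ, hγM, hγ0⟩ := exists_isSmoothCurve_eventually_eq_add_smul hc m
  obtain rfl : γ 0 = c := by simpa using hγ0.self_of_nhds
  have hd := (hasDerivAt_integral_strip Real.two_pi_pos (contDiffOn_metricDensity hγ
    (isSmoothCurve_const h) (isSmoothCurve_const k) hγM) 0).congr_of_eventuallyEq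
      (f₁ := fun t : ℝ => metric (toFun (γ 0 + t • m)) (toFun h) (toFun k))
      (hγ0.mono fun t ht => by beta_reduce; rw [← ht, metric_eq_integral (hγM t)])
  refine hd.congr_deriv ?_
  rw [metric_eq_integral hc, metric_eq_integral hc, ← intervalIntegral.integral_add
    (intervalIntegrable_metricDensity hc _ _) (intervalIntegrable_metricDensity hc _ _)]
  refine intervalIntegral.integral_congr fun θ hθ => ?_
  rw [Set.uIcc_of_le Real.two_pi_pos.le] at hθ
  have hr := curveInvariants_fst_ne_zero (x := jet (γ 0) θ) (hc.1 θ hθ)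
  exact (hasDerivAt_metric_pullback (X := fun t => jet (γ t) θ)
    (contDiffAt_curveInvariants (hc.1 θ hθ))
    ((contDiffAt_halfPlaneMetric hr).differentiableAt (by simp))
    (fderiv_halfPlaneMetric_eq_christoffel hr) (hasDerivAt_jet_of_eventually_eq_add_smul hγ0 θ)
    (congrFun hu θ) (congrFun hw θ)).deriv

theorem IsChartConnection.isLeviCivita {Γ : V → V →ₗ[ℝ] V →ₗ[ℝ] V} (hΓ : IsChartConnection Γ) :
    IsLeviCivita Γ where
  smooth γ η ζ hγ hη hζ hγM := by
    obtain ⟨ξ, hξ, hξγ⟩ := exists_isSmoothCurve_chartDeriv_eq_chartHessian hγ hη hζ hγM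
    have hΓξ : (fun t => Γ (γ t) (η t) (ζ t)) = ξ := funext fun t =>
      chartDeriv_injective (hγM t) ((hΓ _ (hγM t) _ _).trans (hξγ t).symm)
    rwa [hΓξ]
  torsion_free c hc h k := chartDeriv_injective hc (by
    rw [hΓ c hc, hΓ c hc, chartHessian_comm hc])
  metric_compatible c hc m h k := hasDerivAt_metric hc (hΓ c hc m h) (hΓ c hc m k)

/-- The Koszul argument: cyclic permutation turns symmetry and skew-symmetry into `S = -S`. -/
theorem eq_zero_of_symm_of_skew {M : Type*} [AddCommGroup M] [Module ℝ M]
    {B : LinearMap.BilinForm ℝ M} {S : M → M → M} (hB : ∀ x, x ≠ 0 → 0 < B x x)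
    (hsymm : ∀ x y, S x y = S y x) (hskew : ∀ x y z, B (S x y) z = -B (S x z) y) (x y : M) :
    S x y = 0 := by
  have hzero (z : M) : B (S x y) z = 0 := by
    have hcycle : B (S x y) z = -B (S x y) z :=
      calc B (S x y) z = -B (S z x) y := by rw [hskew, hsymm x z]
        _ = B (S y z) x := by rw [hskew, neg_neg, hsymm z y]
        _ = -B (S x y) z := by rw [hskew, hsymm y x]
    linarith
  by_contra hne
  exact (hB _ hne).ne' (hzero _)

theorem IsLeviCivita.eq {Γ Γ' : V → V →ₗ[ℝ] V →ₗ[ℝ] V} (hΓ : IsLeviCivita Γ)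
    (hΓ' : IsLeviCivita Γ') (hc : c ∈ curvesModMot) : Γ c = Γ' c := by
  refine LinearMap.ext₂ fun h k => sub_eq_zero.1 <| eq_zero_of_symm_of_skew (B := metricForm hc)
    (S := fun h k => Γ c h k - Γ' c h k) (fun _ => metricForm_self_pos hc) (fun h k => ?_)
    (fun m h k => ?_) h k
  · simp only [hΓ.torsion_free c hc h k, hΓ'.torsion_free c hc h k]
  · have hder := (hΓ.metric_compatible c hc m h k).unique (hΓ'.metric_compatible c hc m h k)
    rw [metric_comm _ (toFun h), metric_comm _ (toFun h)] at hder
    simp only [LinearMap.map_sub₂, metricForm_apply]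
    linarith

theorem IsLeviCivita.isChartConnection {Γ : V → V →ₗ[ℝ] V →ₗ[ℝ] V} (hΓ : IsLeviCivita Γ) :
    IsChartConnection Γ := by
  obtain ⟨Γ', hΓ'⟩ := exists_isChartConnection
  intro c hc
  rw [hΓ.eq hΓ'.isLeviCivita hc]
  exact hΓ' c hc

end LeviCivita

section Curvature

variable {Γ : V → V →ₗ[ℝ] V →ₗ[ℝ] V} {c : V}

theorem toFun_projIcc (h : V) (θ : ℝ) :
    toFun h (Set.projIcc 0 (2 * Real.pi) Real.two_pi_pos.le θ) = toFun h θ :=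
  congrArg h.1 (Set.projIcc_val Real.two_pi_pos.le _)

theorem IsLeviCivita.exists_toFun_eq_dΓ (hΓ : IsLeviCivita Γ) (hc : c ∈ curvesModMot)
    (m h k : V) : ∃ u : V, dΓ Γ c m h k = toFun u ∧ ∀ θ ∈ J,
      chartDeriv c u θ = fderiv ℝ (covariantHessian curveInvariants halfPlaneChristoffel)
          (jet c θ) (jet m θ) (jet h θ) (jet k θ) -
        fderiv ℝ (fderiv ℝ curveInvariants) (jet c θ) (jet m θ) (jet (Γ c h k) θ) := by
  obtain ⟨γ, hγ, hγM, hγ0⟩ := exists_isSmoothCurve_eventually_eq_add_smul hc m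
  obtain rfl : γ 0 = c := by simpa using hγ0.self_of_nhds
  obtain ⟨u, hu⟩ := exists_hasDerivAt_toFun_and_jet
    (hΓ.smooth γ _ _ hγ (isSmoothCurve_const h) (isSmoothCurve_const k) hγM) 0
  have hdΓ : ∀ θ ∈ J, dΓ Γ (γ 0) m h k θ = toFun u θ := fun θ hθ =>
    ((hu θ hθ).1.congr_of_eventuallyEq (hγ0.mono fun t ht => by beta_reduce; rw [ht])).deriv
  refine ⟨u, funext fun θ => ?_, fun θ hθ => ?_⟩
  · simpa only [dΓ, toFun_projIcc] using
      hdΓ _ (Set.projIcc 0 (2 * Real.pi) Real.two_pi_pos.le θ).2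
  · have h0 := hc.1 θ hθ
    exact fderiv_apply_eq_of_eventually_eq_covariantHessian (X := fun t => jet (γ t) θ)
      (Y := fun t => jet (Γ (γ t) h k) θ) (contDiffAt_curveInvariants h0)
      ((contDiffAt_halfPlaneChristoffel (curveInvariants_fst_ne_zero h0)).differentiableAt
        (by simp)) (hasDerivAt_jet_of_eventually_eq_add_smul hγ0 θ) (hu θ hθ).2
      (Filter.Eventually.of_forall fun t => congrFun (hΓ.isChartConnection _ (hγM t) h k) θ)

theorem IsLeviCivita.exists_toFun_eq_curvatureTensor (hΓ : IsLeviCivita Γ)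
    (hc : c ∈ curvesModMot) (h k l : V) : ∃ R : V, curvatureTensor Γ c h k l = toFun R ∧ ∀ θ ∈ J,
      chartDeriv c R θ = chartCurvature halfPlaneChristoffel (chart c θ) (chartDeriv c h θ)
        (chartDeriv c k θ) (chartDeriv c l θ) := by
  obtain ⟨u, hu, hu'⟩ := hΓ.exists_toFun_eq_dΓ hc h k l
  obtain ⟨w, hw, hw'⟩ := hΓ.exists_toFun_eq_dΓ hc k h l
  refine ⟨u - w + Γ c h (Γ c k l) - Γ c k (Γ c h l), ?_, fun θ hθ => ?_⟩
  · rw [curvatureTensor, hu, hw]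
    rfl
  · have hx : (jet c θ).1 ≠ 0 := hc.1 θ hθ
    have hΓθ (a b : V) := congrFun (hΓ.isChartConnection c hc a b) θ
    have hΓΓ (a b : V) : chartDeriv c (Γ c a (Γ c b l)) θ =
        fderiv ℝ (fderiv ℝ curveInvariants) (jet c θ) (jet a θ) (jet (Γ c b l) θ) +
          halfPlaneChristoffel (chart c θ) (chartDeriv c a θ) (chartHessian c b l θ) := by
      rw [hΓθ, ← hΓθ b l]
      rfl
    have hcurv := chartCurvature_fderiv_apply (contDiffAt_curveInvariants hx)
      ((contDiffAt_halfPlaneChristoffel (curveInvariants_fst_ne_zero hx)).differentiableAt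
        (by simp)) (jet h θ) (jet k θ) (jet l θ)
    simp only [map_sub, map_add, Pi.sub_apply, Pi.add_apply, hu' θ hθ, hw' θ hθ, hΓΓ]
    refine Eq.trans ?_ hcurv
    simp only [chartHessian_apply, chartDeriv_apply, chart]
    abel

theorem IsLeviCivita.metric_curvatureTensor (hΓ : IsLeviCivita Γ) (hc : c ∈ curvesModMot)
    (h k : V) :
    metric (toFun c) (curvatureTensor Γ c h k k) (toFun h) =
      -3 * arcIntegral (toFun c) (fun θ =>
        (tangentialPart (toFun c) (toFun h) θ * normalPart (toFun c) (toFun k) θ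
          - tangentialPart (toFun c) (toFun k) θ * normalPart (toFun c) (toFun h) θ) ^ 2) := by
  obtain ⟨R, hR, hR'⟩ := hΓ.exists_toFun_eq_curvatureTensor hc h k k
  rw [hR, metric_eq_integral hc, arcIntegral, ← intervalIntegral.integral_const_mul]
  refine intervalIntegral.integral_congr fun θ hθ => ?_
  rw [Set.uIcc_of_le Real.two_pi_pos.le] at hθ
  have hcθ := hc.1 θ hθ
  have hr : (chart c θ).1 = speed (toFun c) θ := rfl
  have hn : speed (toFun c) θ ≠ 0 := norm_ne_zero_iff.2 hcθ
  beta_reduce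
  rw [hR' θ hθ, halfPlaneMetric_chartCurvature (hr.trans_ne hn)]
  simp only [fst_chartDeriv hcθ, snd_chartDeriv hθ hcθ, hr]
  field_simp

theorem arcIntegral_sq_nonneg (c : ℝ → Plane) (f : ℝ → ℝ) :
    0 ≤ arcIntegral c fun θ => f θ ^ 2 :=
  intervalIntegral.integral_nonneg Real.two_pi_pos.le fun _ _ =>
    mul_nonneg (sq_nonneg _) (norm_nonneg _)

end Curvature

end PlaneCurves

end

/-- The metric on open plane curves modulo motions has a unique Levi-Civita connection, and its
sectional curvatures are given by the stated formula; in particular they are non-positive. -/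
theorem mainTheorem5 :
    (∃ Γ, PlaneCurves.IsLeviCivita Γ) ∧
    (∀ Γ Γ', PlaneCurves.IsLeviCivita Γ → PlaneCurves.IsLeviCivita Γ' →
      ∀ c ∈ PlaneCurves.curvesModMot, Γ c = Γ' c) ∧
    (∀ Γ, PlaneCurves.IsLeviCivita Γ →
      ∀ c ∈ PlaneCurves.curvesModMot, ∀ h k : PlaneCurves.V, LinearIndependent ℝ ![h, k] →
        0 < PlaneCurves.gram c h k ∧
        PlaneCurves.sectionalCurvature Γ c h k =
          -3 * PlaneCurves.arcIntegral (PlaneCurves.toFun c) (fun θ =>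
              (PlaneCurves.tangentialPart (PlaneCurves.toFun c) (PlaneCurves.toFun h) θ
                  * PlaneCurves.normalPart (PlaneCurves.toFun c) (PlaneCurves.toFun k) θ
                - PlaneCurves.tangentialPart (PlaneCurves.toFun c) (PlaneCurves.toFun k) θ
                  * PlaneCurves.normalPart (PlaneCurves.toFun c) (PlaneCurves.toFun h) θ) ^ 2)
            / PlaneCurves.gram c h k ∧
        PlaneCurves.sectionalCurvature Γ c h k ≤ 0) := by
  refine ⟨PlaneCurves.exists_isChartConnection.imp fun _ hΓ => hΓ.isLeviCivita,
    fun Γ Γ' hΓ hΓ' c hc => hΓ.eq hΓ' hc, fun Γ hΓ c hc h k hi => ?_⟩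
  have hg := PlaneCurves.gram_pos hc hi
  have hs := congrArg (· / PlaneCurves.gram c h k) (hΓ.metric_curvatureTensor hc h k)
  refine ⟨hg, hs, hs.trans_le (div_nonpos_of_nonpos_of_nonneg ?_ hg.le)⟩
  exact mul_nonpos_of_nonpos_of_nonneg (by norm_num) (PlaneCurves.arcIntegral_sq_nonneg _ _)
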